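/- Let $\varphi:\mathbb R^2\to\mathbb R$ be a smooth function that is $1$ on $B(0,2/3)$ and vanishes outside $B(0,3/2)$, and for $k\in\mathbb Z$ let $\varphi_k(\xi)=\varphi(\xi/2^k)-\varphi(\xi/2^{k-1})$ and $k^+=\max(k,0)$. For $R>0$ consider the torus $\mathbb T_R=(\mathbb R/R\mathbb Z)^2$ with Lebesgue measure (of total mass $R^2$), write $\widehat u(\xi)=\int_{\mathbb T_R}e^{-ix\cdot\xi}u(x)\,dx$ for $\xi\in(2\pi\mathbb Z/R)^2$, and let $\Lambda(\xi)=\sqrt{1+|\xi|^2}$. Define $$P_ke^{-it\Lambda}u(x)=\frac1{R^2}\sum_{\xi\in(2\pi\mathbb Z/R)^2}e^{ix\cdot\xi-it\Lambda(\xi)}\varphi_k(\xi)\,\widehat u(\xi),$$ a sum with finitely many nonzero terms. Then there is a constant $C>0$, depending only on $\varphi$, such that for all $R>0$, $k\in\mathbb Z$, $t\ge0$, all $1\le p\le q\le\infty$ with $1/p+1/q=1$, and all complex-valued $u\in L^p(\mathbb T_R)$, $$\|P_ke^{-it\Lambda}u\|_{L^q(\mathbb T_R)}\le C\left[(1+t)^{-1}\left(\frac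 tR+1\right)^2 2^{2k^+}\right]^{1/p-1/q}\|u\|_{L^p(\mathbb T_R)}.$$ -/

import Mathlib

open MeasureTheory
open scoped ENNReal ContDiff

noncomputable section

/-- The flat torus `(ℝ/Rℤ)²`. Its `volume` is the product of the length measures on the circles
`ℝ/Rℤ`, so that the torus has total mass `R²`. -/
abbrev Torus (R : ℝ) : Type := Fin 2 → AddCircle R

/-- The frequency `ξ = 2πn/R ∈ (2πℤ/R)²`, as a vector of the Euclidean plane. -/
def freq (R : ℝ) (n : Fin 2 → ℤ) : EuclideanSpace ℝ (Fin 2) :=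
  WithLp.toLp 2 fun j => 2 * Real.pi * (n j : ℝ) / R

/-- The character `x ↦ e^{i x · ξ}` of the torus, for `ξ = freq R n`
(`fourier m x = e^{2πi m x / R}` on `ℝ/Rℤ`). -/
def torusChar (R : ℝ) (n : Fin 2 → ℤ) (x : Torus R) : ℂ :=
  ∏ j, fourier (n j) (x j)

/-- The Fourier transform `𝓕u(ξ) = ∫ e^{-i x · ξ} u(x) dx` at `ξ = freq R n`. -/
def torusFourier {R : ℝ} [Fact (0 < R)] (u : Torus R → ℂ) (n : Fin 2 → ℤ) : ℂ :=
  ∫ x : Torus R, (starRingEnd ℂ) (torusChar R n x) * u x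

/-- The Fourier multiplier with symbol `m`, that is `𝓕(m(D)u)(ξ) = m(ξ) 𝓕u(ξ)`, given by Fourier
inversion: `m(D)u(x) = R⁻² ∑_ξ e^{i x · ξ} m(ξ) 𝓕u(ξ)`. It is used for compactly supported `m` only,
for which the sum has finitely many nonzero terms. -/
def fourierMultiplier {R : ℝ} [Fact (0 < R)] (m : EuclideanSpace ℝ (Fin 2) → ℂ)
    (u : Torus R → ℂ) (x : Torus R) : ℂ :=
  ((R : ℂ) ^ 2)⁻¹ * ∑' n : Fin 2 → ℤ, torusChar R n x * (m (freq R n) * torusFourier u n)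

/-- A smooth cutoff function: `1` on `B(0, 2/3)` and `0` outside `B(0, 3/2)`. -/
structure IsCutoff (φ : EuclideanSpace ℝ (Fin 2) → ℝ) : Prop where
  smooth : ContDiff ℝ ∞ φ
  eq_one : ∀ ξ ∈ Metric.ball (0 : EuclideanSpace ℝ (Fin 2)) (2 / 3), φ ξ = 1
  eq_zero : ∀ ξ ∉ Metric.ball (0 : EuclideanSpace ℝ (Fin 2)) (3 / 2), φ ξ = 0

/-- The Littlewood–Paley symbol `φ_k(ξ) = φ(ξ/2^k) - φ(ξ/2^(k-1))`. -/
def lpSymbol (φ : EuclideanSpace ℝ (Fin 2) → ℝ) (k : ℤ) (ξ : EuclideanSpace ℝ (Fin 2)) : ℝ :=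
  φ (((2 : ℝ) ^ k)⁻¹ • ξ) - φ (((2 : ℝ) ^ (k - 1))⁻¹ • ξ)

/-- The symbol `Λ(ξ) = √(1 + |ξ|²)`. -/
def lambdaSymbol (ξ : EuclideanSpace ℝ (Fin 2)) : ℝ := √(1 + ‖ξ‖ ^ 2)

/-- The function `P_k e^{-itΛ} u`: the Fourier multiplier with symbol `φ_k(ξ) e^{-itΛ(ξ)}`. -/
def lpKleinGordon {R : ℝ} [Fact (0 < R)] (φ : EuclideanSpace ℝ (Fin 2) → ℝ) (k : ℤ) (t : ℝ)
    (u : Torus R → ℂ) : Torus R → ℂ :=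
  fourierMultiplier
    (fun ξ => (lpSymbol φ k ξ : ℂ) * Complex.exp (-Complex.I * (t : ℂ) * (lambdaSymbol ξ : ℂ))) u

end

/-!
# Dispersive estimates for the Klein–Gordon propagator on large tori

The `L^p → L^q` bound is interpolated between `L² → L²`, which is Bessel's inequality for the
characters and the boundedness of the symbol, and `L¹ → L^∞`, which is a sup bound for the
convolution kernel `R⁻² ∑_ξ e^{ix·ξ} φ_k(ξ) e^{-itΛ(ξ)}` (`exists_norm_kernel_le`). The
interpolation is the Riesz–Thorin argument, by the three lines theorem
(`norm_finiteRankForm_le`).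

The kernel bound does not use stationary phase. In two dimensions `e^{-zΛ}/Λ` has the explicit
kernel `e^{-r}/(2πr)` with `r = √(z² + |y|²)`, for every `z` with `Re z > 0`. For `z = s + it`
one has `Re r · Im r = st`, so that `|e^{-r}/r| ≤ 1/(Re r · Im r) = 1/(st)` everywhere, on the
light cone too, while `Re r` is comparable to `|y|` for `|y| ≥ 2t`. Summing over the period
lattice, of which about `(t/R + 1)²` points lie within distance `t`, gives
`norm_tsum_torusChar_mul_exp_le`.

The kernel is periodized by Poisson summation (`tsum_torusChar_mul_exp`). For real `z` this
follows from the Gaussian case by subordination, that is from the two Cauchy–Schlömilch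
integrals; both sides are analytic in `z`, so it holds on the whole right half-plane.

To pass from `e^{-(s+it)Λ}/Λ` to the localized propagator take `s = 2^{-k⁺}`. The remaining
factor `φ_k Λ e^{sΛ}` is `s⁻¹` times a dilate of a Schwartz function, in a family which stays
bounded as `k` varies (`exists_schwartz_symbol`), and multiplying a Fourier series by such a
symbol averages translates of its sum (`norm_tsum_schwartz_mul_le`). This costs a factor `s⁻¹`,
whence the bound `s⁻² t⁻¹ (t/R + 1)²` for `t ≥ 1`. For `t ≤ 1` it suffices to count frequencies
(`exists_norm_kernel_le_trivial`).
-/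

noncomputable section

namespace KleinGordonTorus

open Set Filter Topology
open scoped FourierTransform SchwartzMap

/-! ### The Cauchy–Schlömilch integrals -/

lemma image_mul_sub_div_Ioi {a b : ℝ} (ha : 0 < a) (hb : 0 < b) :
    (fun v : ℝ => a * v - b / v) '' Ioi 0 = univ := by
  refine eq_univ_of_forall fun w => ?_
  have hab := mul_pos ha hb
  have hlt : |w| < √(w ^ 2 + 4 * (a * b)) := by
    rw [← Real.sqrt_sq_eq_abs]
    exact Real.sqrt_lt_sqrt (sq_nonneg w) (by linarith)
  have hpos : 0 < w + √(w ^ 2 + 4 * (a * b)) := by linarith [neg_abs_le w]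
  have hsq := Real.sq_sqrt (show 0 ≤ w ^ 2 + 4 * (a * b) by positivity)
  refine ⟨(w + √(w ^ 2 + 4 * (a * b))) / (2 * a), ?_, ?_⟩
  · exact div_pos hpos (by linarith)
  · simp only
    set S := √(w ^ 2 + 4 * (a * b))
    field_simp
    nlinarith

lemma hasDerivAt_mul_sub_div {a b v : ℝ} (hv : 0 < v) :
    HasDerivAt (fun v : ℝ => a * v - b / v) (a + b / v ^ 2) v := by
  have h1 : HasDerivAt (fun v : ℝ => a * v) a v := by simpa using (hasDerivAt_id v).const_mul a
  have h2 : HasDerivAt (fun v : ℝ => b / v) (-(b / v ^ 2)) v := by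
    have := (hasDerivAt_inv hv.ne').const_mul b
    simp only [div_eq_mul_inv]
    exact this.congr_deriv (by simp)
  exact (h1.sub h2).congr_deriv (by ring)

lemma injOn_mul_sub_div {a b : ℝ} (ha : 0 < a) (hb : 0 < b) :
    InjOn (fun v : ℝ => a * v - b / v) (Ioi 0) := by
  refine StrictMonoOn.injOn fun x hx y hy hxy => ?_
  have hx : 0 < x := hx
  have : b / y < b / x := div_lt_div_of_pos_left hb hx hxy
  have : a * x < a * y := mul_lt_mul_of_pos_left hxy ha
  linarith

/-- The integrand `e^{-a²v² - b²/v²}` of the Cauchy–Schlömilch integrals. -/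
def schlomilch (a b v : ℝ) : ℝ := Real.exp (-(a ^ 2 * v ^ 2) - b ^ 2 / v ^ 2)

lemma schlomilch_pos (a b v : ℝ) : 0 < schlomilch a b v := Real.exp_pos _

lemma measurable_schlomilch (a b : ℝ) : Measurable (schlomilch a b) := by
  unfold schlomilch; fun_prop

lemma abs_smul_gaussian_eq {a b : ℝ} (ha : 0 < a) (hb : 0 < b) {v : ℝ} (hv : 0 < v) :
    |a + b / v ^ 2| • Real.exp (-1 * (a * v - b / v) ^ 2) =
      Real.exp (2 * a * b) * ((a + b / v ^ 2) * schlomilch a b v) := by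
  rw [abs_of_pos (by positivity), smul_eq_mul, schlomilch, mul_left_comm, ← Real.exp_add]
  congr 2
  field_simp
  ring

lemma integrableOn_weighted_schlomilch {a b : ℝ} (ha : 0 < a) (hb : 0 < b) :
    IntegrableOn (fun v => (a + b / v ^ 2) * schlomilch a b v) (Ioi 0) := by
  have h := (integrableOn_image_iff_integrableOn_abs_deriv_smul measurableSet_Ioi
    (fun v hv => (hasDerivAt_mul_sub_div (a := a) (b := b) hv).hasDerivWithinAt)
    (injOn_mul_sub_div ha hb) (fun w => Real.exp (-1 * w ^ 2))).1 (by
      rw [image_mul_sub_div_Ioi ha hb]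
      exact (integrable_exp_neg_mul_sq one_pos).integrableOn)
  have h2 : IntegrableOn
      (fun v => Real.exp (2 * a * b) * ((a + b / v ^ 2) * schlomilch a b v)) (Ioi 0) :=
    h.congr_fun (fun v hv => abs_smul_gaussian_eq ha hb hv) measurableSet_Ioi
  have h3 := h2.const_mul (Real.exp (2 * a * b))⁻¹
  refine h3.congr (Eventually.of_forall fun v => ?_)
  simp only
  rw [← mul_assoc, inv_mul_cancel₀ (Real.exp_pos _).ne', one_mul]

lemma integral_weighted_schlomilch {a b : ℝ} (ha : 0 < a) (hb : 0 < b) :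
    ∫ v in Ioi 0, (a + b / v ^ 2) * schlomilch a b v = √Real.pi * Real.exp (-(2 * a * b)) := by
  have h := integral_image_eq_integral_abs_deriv_smul measurableSet_Ioi
    (fun v hv => (hasDerivAt_mul_sub_div (a := a) (b := b) hv).hasDerivWithinAt)
    (injOn_mul_sub_div ha hb) (fun w => Real.exp (-1 * w ^ 2))
  rw [image_mul_sub_div_Ioi ha hb, setIntegral_univ, integral_gaussian,
    setIntegral_congr_fun measurableSet_Ioi (fun v hv => abs_smul_gaussian_eq ha hb hv),
    integral_const_mul, div_one] at h
  rw [h, Real.exp_neg]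
  field_simp

lemma integrableOn_schlomilch {a b : ℝ} (ha : 0 < a) (hb : 0 < b) :
    IntegrableOn (schlomilch a b) (Ioi 0) := by
  refine Integrable.mono' ((integrableOn_weighted_schlomilch ha hb).const_mul a⁻¹)
    (measurable_schlomilch a b).aestronglyMeasurable ?_
  filter_upwards [self_mem_ae_restrict measurableSet_Ioi] with v hv
  have hv : 0 < v := hv
  have := schlomilch_pos a b v
  rw [Real.norm_of_nonneg this.le, ← mul_assoc]
  refine le_mul_of_one_le_left this.le ?_
  rw [mul_add, inv_mul_cancel₀ ha.ne']
  have : 0 ≤ a⁻¹ * (b / v ^ 2) := by positivity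
  linarith

lemma integrableOn_schlomilch_div {a b : ℝ} (ha : 0 < a) (hb : 0 < b) :
    IntegrableOn (fun v => schlomilch a b v / v ^ 2) (Ioi 0) := by
  refine Integrable.mono' ((integrableOn_weighted_schlomilch ha hb).const_mul b⁻¹)
    ((measurable_schlomilch a b).div (by fun_prop)).aestronglyMeasurable ?_
  filter_upwards [self_mem_ae_restrict measurableSet_Ioi] with v hv
  have hv : 0 < v := hv
  have := schlomilch_pos a b v
  rw [Real.norm_of_nonneg (by positivity), ← mul_assoc, div_eq_inv_mul]
  refine mul_le_mul_of_nonneg_right ?_ this.le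
  rw [mul_add, div_eq_mul_inv, ← mul_assoc b⁻¹ b, inv_mul_cancel₀ hb.ne', one_mul]
  have : 0 ≤ b⁻¹ * a := by positivity
  linarith

/-- The substitution `v ↦ (b/a)/v` exchanges the two Cauchy–Schlömilch integrals. -/
lemma integral_schlomilch_swap {a b : ℝ} (ha : 0 < a) (hb : 0 < b) :
    a * ∫ v in Ioi 0, schlomilch a b v = b * ∫ v in Ioi 0, schlomilch a b v / v ^ 2 := by
  have hc : 0 < b / a := div_pos hb ha
  have himg : (fun v : ℝ => (b / a) / v) '' Ioi 0 = Ioi 0 := by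
    ext w
    constructor
    · rintro ⟨v, hv, rfl⟩
      exact div_pos hc hv
    · intro hw
      have hw : 0 < w := hw
      exact ⟨(b / a) / w, div_pos hc hw, by field_simp⟩
  have hder : ∀ v ∈ Ioi (0 : ℝ),
      HasDerivWithinAt (fun v : ℝ => (b / a) / v) (-((b / a) / v ^ 2)) (Ioi 0) v := by
    intro v hv
    have hv : 0 < v := hv
    have := (hasDerivAt_inv hv.ne').const_mul (b / a)
    refine HasDerivAt.hasDerivWithinAt ?_
    simp only [div_eq_mul_inv] at this ⊢
    exact this.congr_deriv (by simp)
  have hinj : InjOn (fun v : ℝ => (b / a) / v) (Ioi 0) := by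
    intro x hx y hy h
    have hx : 0 < x := hx
    have hy : 0 < y := hy
    simp only at h
    field_simp at h
    exact h.symm
  have h := integral_image_eq_integral_abs_deriv_smul measurableSet_Ioi hder hinj (schlomilch a b)
  rw [himg] at h
  rw [h, ← integral_const_mul, ← integral_const_mul]
  refine setIntegral_congr_fun measurableSet_Ioi fun v hv => ?_
  have hv : 0 < v := hv
  have hs : schlomilch a b (b / a / v) = schlomilch a b v := by
    unfold schlomilch
    congr 1
    field_simp
    ring
  simp only [smul_eq_mul, hs, abs_neg]
  rw [abs_of_pos (by positivity)]
  field_simp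

lemma integral_schlomilch_add {a b : ℝ} (ha : 0 < a) (hb : 0 < b) :
    (a * ∫ v in Ioi 0, schlomilch a b v) + b * ∫ v in Ioi 0, schlomilch a b v / v ^ 2 =
      √Real.pi * Real.exp (-(2 * a * b)) := by
  rw [← integral_weighted_schlomilch ha hb, ← integral_const_mul, ← integral_const_mul,
    ← integral_add ((integrableOn_schlomilch ha hb).const_mul a)
      ((integrableOn_schlomilch_div ha hb).const_mul b)]
  refine integral_congr_ae (Eventually.of_forall fun v => ?_)
  simp only
  ring

lemma integral_schlomilch {a b : ℝ} (ha : 0 < a) (hb : 0 < b) :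
    ∫ v in Ioi 0, schlomilch a b v = √Real.pi * Real.exp (-(2 * a * b)) / (2 * a) := by
  have h1 := integral_schlomilch_swap ha hb
  have h2 := integral_schlomilch_add ha hb
  field_simp
  linarith

lemma integral_schlomilch_div {a b : ℝ} (ha : 0 < a) (hb : 0 < b) :
    ∫ v in Ioi 0, schlomilch a b v / v ^ 2 =
      √Real.pi * Real.exp (-(2 * a * b)) / (2 * b) := by
  have h1 := integral_schlomilch_swap ha hb
  have h2 := integral_schlomilch_add ha hb
  field_simp
  linarith

/-! ### Sums over lattices -/

lemma summable_tsum_inv_one_add_mul_sq {ρ : ℝ} (hρ : 0 < ρ) :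
    Summable (fun j : ℕ => (1 + (ρ * j) ^ 2)⁻¹) ∧ ∑' j : ℕ, (1 + (ρ * j) ^ 2)⁻¹ ≤ 1 + 2 / ρ := by
  -- `(1 + ρ²j²)⁻¹ ≤ 2 (1 + ρj)⁻²`, which is bounded by a telescoping difference
  have hpart : ∀ N : ℕ, ∑ j ∈ Finset.range N, (1 + (ρ * j) ^ 2)⁻¹ ≤ 1 + 2 / ρ := by
    intro N
    have key : ∀ N : ℕ, ∑ j ∈ Finset.range (N + 1), (1 + (ρ * j) ^ 2)⁻¹ ≤
        1 + 2 / ρ * (1 - (1 + ρ * N)⁻¹) := by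
      intro N
      induction N with
      | zero => simp
      | succ N ih =>
        rw [Finset.sum_range_succ]
        have hN : (0 : ℝ) ≤ N := Nat.cast_nonneg N
        have hstep : (1 + (ρ * ((N + 1 : ℕ) : ℝ)) ^ 2)⁻¹ ≤
            2 / ρ * ((1 + ρ * N)⁻¹ - (1 + ρ * ((N + 1 : ℕ) : ℝ))⁻¹) := by
          push_cast
          have hx : 0 ≤ ρ * N := by positivity
          have e : 2 / ρ * ((1 + ρ * N)⁻¹ - (1 + ρ * ((N : ℝ) + 1))⁻¹) =
              2 / ((1 + ρ * N) * (1 + ρ * ((N : ℝ) + 1))) := by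
            field_simp
            ring
          rw [e, inv_eq_one_div, div_le_div_iff₀ (by positivity) (by positivity)]
          nlinarith [sq_nonneg (ρ * ((N : ℝ) + 1) - 1)]
        linarith
    cases N with
    | zero => simp; positivity
    | succ N =>
      refine (key N).trans ?_
      have : 0 ≤ 2 / ρ * (1 + ρ * (N : ℝ))⁻¹ := by positivity
      linarith
  have hs : Summable (fun j : ℕ => (1 + (ρ * j) ^ 2)⁻¹) :=
    summable_of_sum_range_le (fun j => by positivity) hpart
  exact ⟨hs, hs.tsum_le_of_sum_range_le hpart⟩

lemma summable_tsum_lattice_one {ρ : ℝ} (hρ : 0 < ρ) (y : ℝ) :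
    Summable (fun m : ℤ => (1 + (y - ρ * m) ^ 2)⁻¹) ∧
      ∑' m : ℤ, (1 + (y - ρ * m) ^ 2)⁻¹ ≤ 2 * (1 + 2 / ρ) := by
  obtain ⟨hs, hle⟩ := summable_tsum_inv_one_add_mul_sq hρ
  -- recentre the lattice at the point closest to `y` from below
  set m₀ : ℤ := ⌊y / ρ⌋
  set f : ℤ → ℝ := fun m => (1 + (y - ρ * ((m₀ - m : ℤ) : ℝ)) ^ 2)⁻¹
  have hθ0 : 0 ≤ y - ρ * m₀ := by
    have := Int.floor_le (y / ρ)
    rw [le_div_iff₀ hρ] at this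
    linarith
  have hθ1 : y - ρ * m₀ ≤ ρ := by
    have := (Int.lt_floor_add_one (y / ρ)).le
    rw [div_le_iff₀ hρ] at this
    linarith
  have h1 : ∀ j : ℕ, f j ≤ (1 + (ρ * j) ^ 2)⁻¹ := by
    intro j
    have : 0 ≤ ρ * (j : ℝ) := by positivity
    refine inv_anti₀ (by positivity) ?_
    push_cast
    nlinarith
  have h2 : ∀ j : ℕ, f (-(j + 1)) ≤ (1 + (ρ * j) ^ 2)⁻¹ := by
    intro j
    have : 0 ≤ ρ * (j : ℝ) := by positivity
    refine inv_anti₀ (by positivity) ?_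
    push_cast
    nlinarith
  have hs1 : Summable (fun j : ℕ => f j) := hs.of_nonneg_of_le (fun j => by positivity) h1
  have hs2 : Summable (fun j : ℕ => f (-(j + 1))) :=
    hs.of_nonneg_of_le (fun j => by positivity) h2
  have hf : Summable f := Summable.of_nat_of_neg_add_one hs1 hs2
  have hsum := tsum_of_nat_of_neg_add_one hs1 hs2
  have e : ∀ m, f (Equiv.subLeft m₀ m) = (1 + (y - ρ * m) ^ 2)⁻¹ := by
    intro m
    simp [f]
  refine ⟨?_, ?_⟩
  · have := (Equiv.subLeft m₀).summable_iff.2 hf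
    exact this.congr e
  · calc ∑' m : ℤ, (1 + (y - ρ * m) ^ 2)⁻¹ = ∑' m, f (Equiv.subLeft m₀ m) :=
        tsum_congr fun m => (e m).symm
      _ = ∑' m, f m := (Equiv.subLeft m₀).tsum_eq f
      _ ≤ 2 * (1 + 2 / ρ) := by
        rw [hsum]
        have a1 := hs1.tsum_le_tsum h1 hs
        have a2 := hs2.tsum_le_tsum h2 hs
        linarith

lemma summable_tsum_lattice {L M : ℝ} (hL : 0 < L) (hM : 0 < M) (y : ℝ) :
    Summable (fun m : ℤ => (1 + ((y - L * m) / M) ^ 2)⁻¹) ∧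
      ∑' m : ℤ, (1 + ((y - L * m) / M) ^ 2)⁻¹ ≤ 4 * (M / L + 1) := by
  have h := summable_tsum_lattice_one (div_pos hL hM) (y / M)
  have e : ∀ m : ℤ, y / M - L / M * m = (y - L * m) / M := fun m => by ring
  simp only [e] at h
  refine ⟨h.1, h.2.trans ?_⟩
  rw [← div_mul, mul_comm (2 / L)]
  have : M * (2 / L) = 2 * (M / L) := by ring
  rw [this]
  linarith

lemma summable_norm_mul_fin_two {𝕜 : Type*} [RCLike 𝕜] {f g : ℤ → 𝕜} (hf : Summable fun n => ‖f n‖)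
    (hg : Summable fun n => ‖g n‖) :
    Summable (fun n : Fin 2 → ℤ => ‖f (n 0) * g (n 1)‖) := by
  have h := hf.mul_norm hg
  exact ((finTwoArrowEquiv ℤ).summable_iff (f := fun p : ℤ × ℤ => ‖f p.1 * g p.2‖)).2 h

lemma tsum_mul_fin_two {𝕜 : Type*} [RCLike 𝕜] {f g : ℤ → 𝕜} (hf : Summable fun n => ‖f n‖)
    (hg : Summable fun n => ‖g n‖) :
    ∑' n : Fin 2 → ℤ, f (n 0) * g (n 1) = (∑' n, f n) * ∑' n, g n := by
  rw [tsum_mul_tsum_of_summable_norm hf hg]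
  exact (finTwoArrowEquiv ℤ).tsum_eq (fun p : ℤ × ℤ => f p.1 * g p.2)

/-- The weight `∏ⱼ (1 + (yⱼ/M)²)⁻¹` at the points `y = x - L m` of a shifted square lattice. -/
def latticeWeight (L M : ℝ) (x : Fin 2 → ℝ) (m : Fin 2 → ℤ) : ℝ :=
  (1 + ((x 0 - L * m 0) / M) ^ 2)⁻¹ * (1 + ((x 1 - L * m 1) / M) ^ 2)⁻¹

lemma summable_latticeWeight {L M : ℝ} (hL : 0 < L) (hM : 0 < M) (x : Fin 2 → ℝ) :
    Summable (latticeWeight L M x) := by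
  have h := fun j => (summable_tsum_lattice hL hM (x j)).1
  have := summable_norm_mul_fin_two (𝕜 := ℝ) (h 0).norm (h 1).norm
  exact this.of_norm

lemma tsum_latticeWeight_le {L M : ℝ} (hL : 0 < L) (hM : 0 < M) (x : Fin 2 → ℝ) :
    ∑' m, latticeWeight L M x m ≤ 16 * (M / L + 1) ^ 2 := by
  have h := fun j => summable_tsum_lattice hL hM (x j)
  have e := tsum_mul_fin_two (𝕜 := ℝ) (h 0).1.norm (h 1).1.norm
  unfold latticeWeight
  rw [e]
  have : 0 < M / L := by positivity
  calc _ ≤ (4 * (M / L + 1)) * (4 * (M / L + 1)) :=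
        mul_le_mul (h 0).2 (h 1).2 (tsum_nonneg fun m => by positivity) (by positivity)
    _ = _ := by ring

/-- Exponential decay at the scale `M` beats the weight `latticeWeight`. -/
lemma exp_neg_mul_sqrt_le {δ L M : ℝ} (hδ : 0 < δ) (x : Fin 2 → ℝ) (m : Fin 2 → ℤ) :
    Real.exp (-(δ * √(1 + ((x 0 - L * m 0) ^ 2 + (x 1 - L * m 1) ^ 2) / M ^ 2))) ≤
      24 / δ ^ 4 * latticeWeight L M x m := by
  have e : ((x 0 - L * m 0) ^ 2 + (x 1 - L * m 1) ^ 2) / M ^ 2 =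
      ((x 0 - L * m 0) / M) ^ 2 + ((x 1 - L * m 1) / M) ^ 2 := by ring
  rw [e, latticeWeight]
  set p := ((x 0 - L * m 0) / M) ^ 2
  set q := ((x 1 - L * m 1) / M) ^ 2
  have hp : 0 ≤ p := sq_nonneg _
  have hq : 0 ≤ q := sq_nonneg _
  have h1 := Real.pow_div_factorial_le_exp (δ * √(1 + (p + q))) (by positivity) 4
  have h2 : (δ * √(1 + (p + q))) ^ 4 = δ ^ 4 * (1 + (p + q)) ^ 2 := by
    rw [mul_pow, show (4 : ℕ) = 2 * 2 from rfl, pow_mul (√_), Real.sq_sqrt (by positivity)]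
  have h3 : (0 : ℝ) < (1 + p) * (1 + q) := by positivity
  have h4 : (1 + p) * (1 + q) ≤ (1 + (p + q)) ^ 2 := by nlinarith [mul_nonneg hp hq]
  have h5 : 0 < δ ^ 4 := by positivity
  rw [h2] at h1
  norm_num [Nat.factorial] at h1
  rw [Real.exp_neg, ← mul_inv, ← div_eq_mul_inv, inv_eq_one_div, div_div,
    div_le_div_iff₀ (Real.exp_pos _) (by positivity)]
  nlinarith [mul_le_mul_of_nonneg_left h4 h5.le]

/-! ### Poisson summation for the kernel of `e^{-zΛ}/Λ` -/

/-- The class in the torus of a point of the plane. -/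
def toTorus (R : ℝ) (x : Fin 2 → ℝ) : Torus R := fun j => (x j : AddCircle R)

lemma toTorus_surjective (R : ℝ) : Function.Surjective (toTorus R) := fun y => by
  choose x hx using fun j => QuotientAddGroup.mk_surjective (y j)
  exact ⟨x, funext hx⟩

lemma torusChar_eq_mul (R : ℝ) (n : Fin 2 → ℤ) (x : Torus R) :
    torusChar R n x = fourier (n 0) (x 0) * fourier (n 1) (x 1) := by
  simp [torusChar, Fin.prod_univ_two]

lemma norm_torusChar (R : ℝ) (n : Fin 2 → ℤ) (x : Torus R) : ‖torusChar R n x‖ = 1 := by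
  simp only [torusChar_eq_mul, norm_mul, fourier_apply, Circle.norm_coe, mul_one]

lemma norm_freq_sq (R : ℝ) (n : Fin 2 → ℤ) :
    ‖freq R n‖ ^ 2 = (2 * Real.pi * n 0 / R) ^ 2 + (2 * Real.pi * n 1 / R) ^ 2 := by
  simp only [freq, EuclideanSpace.norm_sq_eq, Fin.sum_univ_two, Real.norm_eq_abs, sq_abs]

lemma one_le_lambdaSymbol (ξ : EuclideanSpace ℝ (Fin 2)) : 1 ≤ lambdaSymbol ξ := by
  unfold lambdaSymbol
  rw [Real.one_le_sqrt]
  nlinarith [sq_nonneg ‖ξ‖]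

lemma lambdaSymbol_sq (ξ : EuclideanSpace ℝ (Fin 2)) : lambdaSymbol ξ ^ 2 = 1 + ‖ξ‖ ^ 2 :=
  Real.sq_sqrt (by positivity)

/-- The squared distance from `x` to the point `R m` of the period lattice. -/
def distSq (R : ℝ) (x : Fin 2 → ℝ) (m : Fin 2 → ℤ) : ℝ :=
  (x 0 - R * m 0) ^ 2 + (x 1 - R * m 1) ^ 2

lemma distSq_nonneg (R : ℝ) (x : Fin 2 → ℝ) (m : Fin 2 → ℤ) : 0 ≤ distSq R x m := by
  unfold distSq; positivity

lemma tsum_fourier_mul_gaussian {R v : ℝ} (hR : 0 < R) (hv : 0 < v) (x : ℝ) :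
    ∑' n : ℤ, fourier n (x : AddCircle R) *
        (Real.exp (-(v ^ 2 * (2 * Real.pi * n / R) ^ 2)) : ℂ) =
      (R / (2 * √Real.pi * v) : ℝ) *
        ∑' m : ℤ, (Real.exp (-((x - R * m) ^ 2 / (4 * v ^ 2))) : ℂ) := by
  have hpi := Real.pi_pos
  set a : ℝ := 4 * Real.pi * v ^ 2 / R ^ 2 with ha
  have ha0 : 0 < a := by positivity
  have h := Complex.tsum_exp_neg_quadratic (a := (a : ℂ)) (by simpa using ha0)
    (Complex.I * x / R)
  have hRc : (R : ℂ) ≠ 0 := by exact_mod_cast hR.ne'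
  have hvc : (v : ℂ) ≠ 0 := by exact_mod_cast hv.ne'
  have hpic : (Real.pi : ℂ) ≠ 0 := by exact_mod_cast hpi.ne'
  have hsq : (a : ℂ) ^ (1 / 2 : ℂ) = ((2 * √Real.pi * v / R : ℝ) : ℂ) := by
    rw [show (1 / 2 : ℂ) = ((1 / 2 : ℝ) : ℂ) by push_cast; rfl, ← Complex.ofReal_cpow ha0.le,
      ← Real.sqrt_eq_rpow]
    congr 1
    rw [Real.sqrt_eq_iff_mul_self_eq ha0.le (by positivity), ha]
    have := Real.mul_self_sqrt hpi.le
    field_simp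
    nlinarith
  rw [hsq] at h
  convert h using 1
  · refine tsum_congr fun n => ?_
    rw [fourier_coe_apply, Complex.ofReal_exp, ← Complex.exp_add]
    congr 1
    rw [ha]
    push_cast
    field_simp
    ring
  · congr 1
    · push_cast
      field_simp
    · refine tsum_congr fun n => ?_
      rw [Complex.ofReal_exp]
      congr 1
      rw [ha]
      have : Complex.I * (Complex.I * x / R) = -(x / R : ℂ) := by
        rw [mul_div_assoc, ← mul_assoc, Complex.I_mul_I]; ring
      rw [this]
      push_cast
      field_simp
      ring

lemma summable_exp_neg_sq_lattice {L c : ℝ} (hL : 0 < L) (hc : 0 < c) (y : ℝ) :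
    Summable (fun m : ℤ => Real.exp (-(c * (y - L * m) ^ 2))) := by
  have h := (summable_tsum_lattice hL (M := (√c)⁻¹) (by positivity) y).1
  refine h.of_nonneg_of_le (fun m => (Real.exp_pos _).le) fun m => ?_
  rw [Real.exp_neg]
  refine inv_anti₀ (by positivity) ?_
  have : ((y - L * m) / (√c)⁻¹) ^ 2 = c * (y - L * m) ^ 2 := by
    rw [div_inv_eq_mul, mul_pow, Real.sq_sqrt hc.le]; ring
  rw [this]
  linarith [Real.add_one_le_exp (c * (y - L * m) ^ 2)]

/-- Poisson summation for the heat kernel of the plane at time `v²`. -/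
lemma tsum_torusChar_mul_gaussian {R v : ℝ} (hR : 0 < R) (hv : 0 < v) (x : Fin 2 → ℝ) :
    ∑' n : Fin 2 → ℤ, torusChar R n (toTorus R x) *
        (Real.exp (-(v ^ 2 * ‖freq R n‖ ^ 2)) : ℂ) =
      (R ^ 2 / (4 * Real.pi * v ^ 2) : ℝ) *
        ∑' m : Fin 2 → ℤ, (Real.exp (-(distSq R x m / (4 * v ^ 2))) : ℂ) := by
  have hpi := Real.pi_pos
  have e1 : ∀ n : Fin 2 → ℤ, torusChar R n (toTorus R x) *
      (Real.exp (-(v ^ 2 * ‖freq R n‖ ^ 2)) : ℂ) =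
      (fourier (n 0) (x 0 : AddCircle R) *
        (Real.exp (-(v ^ 2 * (2 * Real.pi * n 0 / R) ^ 2)) : ℂ)) *
      (fourier (n 1) (x 1 : AddCircle R) *
        (Real.exp (-(v ^ 2 * (2 * Real.pi * n 1 / R) ^ 2)) : ℂ)) := by
    intro n
    rw [torusChar_eq_mul, norm_freq_sq, mul_add, neg_add, Real.exp_add]
    simp only [toTorus]
    push_cast
    ring
  have e2 : ∀ m : Fin 2 → ℤ, (Real.exp (-(distSq R x m / (4 * v ^ 2))) : ℂ) =
      (Real.exp (-((x 0 - R * m 0) ^ 2 / (4 * v ^ 2))) : ℂ) *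
      (Real.exp (-((x 1 - R * m 1) ^ 2 / (4 * v ^ 2))) : ℂ) := by
    intro m
    rw [distSq, add_div, neg_add, Real.exp_add]
    push_cast
    ring
  have s1 : ∀ y : ℝ, Summable fun n : ℤ => ‖fourier n (y : AddCircle R) *
        (Real.exp (-(v ^ 2 * (2 * Real.pi * n / R) ^ 2)) : ℂ)‖ := by
    intro y
    refine (summable_exp_neg_sq_lattice (L := 2 * Real.pi / R) (c := v ^ 2) (by positivity)
      (by positivity) 0).congr fun n => ?_
    rw [norm_mul, Complex.norm_real, Real.norm_of_nonneg (Real.exp_pos _).le]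
    simp only [fourier_apply, Circle.norm_coe, one_mul]
    congr 1
    ring
  have s2 : ∀ y : ℝ, Summable fun m : ℤ =>
      ‖(Real.exp (-((y - R * m) ^ 2 / (4 * v ^ 2))) : ℂ)‖ := by
    intro y
    refine (summable_exp_neg_sq_lattice hR (c := 1 / (4 * v ^ 2)) (by positivity) y).congr
      fun n => ?_
    rw [Complex.norm_real, Real.norm_of_nonneg (Real.exp_pos _).le]
    congr 1
    ring
  rw [tsum_congr e1, tsum_congr e2]
  rw [tsum_mul_fin_two (s1 (x 0)) (s1 (x 1)), tsum_mul_fin_two (s2 (x 0)) (s2 (x 1)),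
    tsum_fourier_mul_gaussian hR hv, tsum_fourier_mul_gaussian hR hv]
  have : ((R ^ 2 / (4 * Real.pi * v ^ 2) : ℝ) : ℂ) =
      ((R / (2 * √Real.pi * v) : ℝ) : ℂ) * ((R / (2 * √Real.pi * v) : ℝ) : ℂ) := by
    rw [← Complex.ofReal_mul]
    congr 1
    have := Real.mul_self_sqrt hpi.le
    rw [div_mul_div_comm]
    congr 1
    · ring
    · nlinarith
  rw [this]
  ring

lemma summable_exp_neg_sqrt {δ L M : ℝ} (hδ : 0 < δ) (hL : 0 < L) (hM : 0 < M) (x : Fin 2 → ℝ) :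
    Summable (fun m => Real.exp (-(δ * √(1 + distSq L x m / M ^ 2)))) :=
  ((summable_latticeWeight hL hM x).mul_left (24 / δ ^ 4)).of_nonneg_of_le
    (fun _ => (Real.exp_pos _).le) (exp_neg_mul_sqrt_le hδ x)

lemma summable_exp_neg_lambdaSymbol {R δ : ℝ} (hR : 0 < R) (hδ : 0 < δ) :
    Summable (fun n => Real.exp (-(δ * lambdaSymbol (freq R n)))) := by
  have hpi := Real.pi_pos
  refine (summable_exp_neg_sqrt (L := 2 * Real.pi / R) (M := 1) hδ (by positivity) one_pos
    0).congr fun n => ?_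
  rw [lambdaSymbol, norm_freq_sq, distSq]
  congr 4
  simp only [Pi.zero_apply]
  ring

/-- Poisson summation for the kernel of `e^{-sΛ}/Λ`, from the heat kernel by subordination. -/
lemma tsum_torusChar_mul_exp_real {R s : ℝ} (hR : 0 < R) (hs : 0 < s) (x : Fin 2 → ℝ) :
    ∑' n : Fin 2 → ℤ, torusChar R n (toTorus R x) *
        ((Real.exp (-(s * lambdaSymbol (freq R n))) / lambdaSymbol (freq R n) : ℝ) : ℂ) =
      ((R ^ 2 / (2 * Real.pi) : ℝ) : ℂ) * ∑' m : Fin 2 → ℤ,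
        ((Real.exp (-√(s ^ 2 + distSq R x m)) / √(s ^ 2 + distSq R x m) : ℝ) : ℂ) := by
  have hpi := Real.pi_pos
  set Λ : (Fin 2 → ℤ) → ℝ := fun n => lambdaSymbol (freq R n) with hΛ
  have hΛ1 : ∀ n, 1 ≤ Λ n := fun n => one_le_lambdaSymbol _
  have hΛ0 : ∀ n, 0 < Λ n := fun n => one_pos.trans_le (hΛ1 n)
  set r : (Fin 2 → ℤ) → ℝ := fun m => √(s ^ 2 + distSq R x m) with hr
  have hrs : ∀ m, s ≤ r m := fun m => Real.le_sqrt_of_sq_le (by linarith [distSq_nonneg R x m])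
  have hr0 : ∀ m, 0 < r m := fun m => hs.trans_le (hrs m)
  have hr2 : ∀ m, r m ^ 2 = s ^ 2 + distSq R x m := fun m =>
    Real.sq_sqrt (add_nonneg (sq_nonneg s) (distSq_nonneg R x m))
  set F : (Fin 2 → ℤ) → ℝ → ℂ := fun n v =>
    torusChar R n (toTorus R x) * (schlomilch (Λ n) (s / 2) v : ℂ) with hF
  set G : (Fin 2 → ℤ) → ℝ → ℂ := fun m v =>
    ((R ^ 2 / (4 * Real.pi) : ℝ) : ℂ) * ((schlomilch 1 (r m / 2) v / v ^ 2 : ℝ) : ℂ) with hG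
  have hFI : ∀ n, Integrable (F n) (volume.restrict (Ioi 0)) := fun n =>
    (integrableOn_schlomilch (hΛ0 n) (half_pos hs)).ofReal.const_mul _
  have hGI : ∀ m, Integrable (G m) (volume.restrict (Ioi 0)) := fun m =>
    (integrableOn_schlomilch_div one_pos (half_pos (hr0 m))).ofReal.const_mul _
  have hFn : ∀ n, ∫ v in Ioi 0, ‖F n v‖ = √Real.pi / 2 * (Real.exp (-(s * Λ n)) / Λ n) := by
    intro n
    have : ∀ v, ‖F n v‖ = schlomilch (Λ n) (s / 2) v := fun v => by
      rw [norm_mul, norm_torusChar, one_mul, Complex.norm_real,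
        Real.norm_of_nonneg (schlomilch_pos _ _ _).le]
    simp only [this]
    rw [integral_schlomilch (hΛ0 n) (half_pos hs)]
    rw [show 2 * Λ n * (s / 2) = s * Λ n by ring]
    ring
  have hGn : ∀ m, ∫ v in Ioi 0, ‖G m v‖ =
      R ^ 2 / (4 * Real.pi) * (√Real.pi * (Real.exp (-r m) / r m)) := by
    intro m
    have : ∀ v, ‖G m v‖ = R ^ 2 / (4 * Real.pi) * (schlomilch 1 (r m / 2) v / v ^ 2) := fun v => by
      have := schlomilch_pos 1 (r m / 2) v
      rw [norm_mul, Complex.norm_real, Complex.norm_real, Real.norm_of_nonneg (by positivity),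
        Real.norm_of_nonneg (by positivity)]
    simp only [this]
    rw [integral_const_mul, integral_schlomilch_div one_pos (half_pos (hr0 m))]
    rw [show 2 * 1 * (r m / 2) = r m by ring]
    have := hr0 m
    field_simp
  have hFi : ∀ n, ∫ v in Ioi 0, F n v = ((√Real.pi / 2 : ℝ) : ℂ) *
      (torusChar R n (toTorus R x) * ((Real.exp (-(s * Λ n)) / Λ n : ℝ) : ℂ)) := by
    intro n
    rw [hF, integral_const_mul, integral_complex_ofReal, integral_schlomilch (hΛ0 n) (half_pos hs),
      mul_left_comm, ← Complex.ofReal_mul]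
    congr 2
    rw [show 2 * Λ n * (s / 2) = s * Λ n by ring]
    ring
  have hGi : ∀ m, ∫ v in Ioi 0, G m v = ((√Real.pi / 2 : ℝ) : ℂ) *
      (((R ^ 2 / (2 * Real.pi) : ℝ) : ℂ) * ((Real.exp (-r m) / r m : ℝ) : ℂ)) := by
    intro m
    rw [hG, integral_const_mul, integral_complex_ofReal,
      integral_schlomilch_div one_pos (half_pos (hr0 m)), ← Complex.ofReal_mul,
      ← Complex.ofReal_mul, ← Complex.ofReal_mul]
    congr 1
    rw [show 2 * 1 * (r m / 2) = r m by ring]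
    have := hr0 m
    field_simp
    ring
  have hFs : Summable fun n => ∫ v in Ioi 0, ‖F n v‖ := by
    simp only [hFn]
    refine ((summable_exp_neg_lambdaSymbol hR hs).of_nonneg_of_le
      (fun n => div_nonneg (Real.exp_pos _).le (hΛ0 n).le) fun n => ?_).mul_left _
    exact div_le_self (Real.exp_pos _).le (hΛ1 n)
  have hGs : Summable fun m => ∫ v in Ioi 0, ‖G m v‖ := by
    simp only [hGn]
    refine Summable.mul_left _ (Summable.mul_left _ ?_)
    refine ((summable_exp_neg_sqrt hs hR hs x).mul_right s⁻¹).of_nonneg_of_le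
      (fun m => div_nonneg (Real.exp_pos _).le (hr0 m).le) fun m => ?_
    have : s * √(1 + distSq R x m / s ^ 2) = r m := by
      rw [hr]
      nth_rewrite 1 [← Real.sqrt_sq hs.le]
      rw [← Real.sqrt_mul (sq_nonneg s)]
      congr 1
      field_simp
    rw [this, ← div_eq_mul_inv]
    exact div_le_div_of_nonneg_left (Real.exp_pos _).le hs (hrs m)
  have hFS := (hasSum_integral_of_summable_integral_norm hFI hFs).tsum_eq
  have hGS := (hasSum_integral_of_summable_integral_norm hGI hGs).tsum_eq
  have hFG : ∫ v in Ioi 0, ∑' n, F n v = ∫ v in Ioi 0, ∑' m, G m v := by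
    refine setIntegral_congr_fun measurableSet_Ioi fun v hv => ?_
    have hv : 0 < v := hv
    have hp := tsum_torusChar_mul_gaussian hR hv x
    have eF : ∀ n, F n v = (Real.exp (-v ^ 2 - s ^ 2 / (4 * v ^ 2)) : ℂ) *
        (torusChar R n (toTorus R x) * (Real.exp (-(v ^ 2 * ‖freq R n‖ ^ 2)) : ℂ)) := by
      intro n
      simp only [hF, schlomilch, hΛ]
      rw [mul_left_comm, ← Complex.ofReal_mul, ← Real.exp_add, lambdaSymbol_sq]
      congr 3
      field_simp
      ring
    have eG : ∀ m, G m v = (Real.exp (-v ^ 2 - s ^ 2 / (4 * v ^ 2)) : ℂ) *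
        (((R ^ 2 / (4 * Real.pi * v ^ 2) : ℝ) : ℂ) *
          (Real.exp (-(distSq R x m / (4 * v ^ 2))) : ℂ)) := by
      intro m
      simp only [hG, schlomilch]
      rw [mul_left_comm _ ((R ^ 2 / (4 * Real.pi * v ^ 2) : ℝ) : ℂ), ← Complex.ofReal_mul,
        ← Complex.ofReal_mul, ← Complex.ofReal_mul, ← Real.exp_add, div_pow, hr2,
        show -(1 ^ 2 * v ^ 2) - (s ^ 2 + distSq R x m) / 2 ^ 2 / v ^ 2 =
          -v ^ 2 - s ^ 2 / (4 * v ^ 2) + -(distSq R x m / (4 * v ^ 2)) by field_simp; ring]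
      congr 1
      field_simp
    simp only [eF, eG]
    rw [tsum_mul_left, tsum_mul_left, hp, tsum_mul_left]
  rw [← hFS, ← hGS] at hFG
  simp only [hFi, hGi] at hFG
  rw [tsum_mul_left, tsum_mul_left, tsum_mul_left] at hFG
  exact mul_left_cancel₀ (by
    rw [Complex.ofReal_ne_zero]; positivity) hFG

/-! ### Analytic continuation to complex time -/

/-- The complex distance `√(z² + w)`, where `w` is a squared distance in the plane; for `z = it` it
is the Lorentzian distance of the light cone. -/
def complexDist (z : ℂ) (w : ℝ) : ℂ := (z ^ 2 + w) ^ (2⁻¹ : ℂ)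

lemma sq_complexDist (z : ℂ) (w : ℝ) : complexDist z w ^ 2 = z ^ 2 + w := by
  simp [complexDist]

lemma complexDist_ofReal {s w : ℝ} (hw : 0 ≤ w) :
    complexDist s w = (√(s ^ 2 + w) : ℝ) := by
  rw [complexDist, Real.sqrt_eq_rpow, Complex.ofReal_cpow (by positivity)]
  push_cast
  norm_num

lemma complexDist_re_sq_sub (z : ℂ) (w : ℝ) :
    (complexDist z w).re ^ 2 - (complexDist z w).im ^ 2 = z.re ^ 2 - z.im ^ 2 + w := by
  have := congrArg Complex.re (sq_complexDist z w)
  simp [sq] at this ⊢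
  linarith

lemma complexDist_re_mul_im (z : ℂ) (w : ℝ) :
    (complexDist z w).re * (complexDist z w).im = z.re * z.im := by
  have := congrArg Complex.im (sq_complexDist z w)
  simp [sq] at this
  linarith

lemma complexDist_re_pos {z : ℂ} (hz : 0 < z.re) {w : ℝ} (hw : 0 ≤ w) :
    0 < (complexDist z w).re := by
  have h0 : 0 ≤ (complexDist z w).re := by
    rw [complexDist, Complex.cpow_inv_two_re]
    exact Real.sqrt_nonneg _
  refine h0.lt_of_ne' fun h => ?_
  have h1 := complexDist_re_sq_sub z w
  have h2 := complexDist_re_mul_im z w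
  rw [h, zero_mul, eq_comm, mul_eq_zero, or_iff_right hz.ne'] at h2
  rw [h, h2] at h1
  nlinarith [sq_nonneg (complexDist z w).im, pow_pos hz 2]

lemma normSq_pos_of_re_pos {z : ℂ} (hz : 0 < z.re) : 0 < z.re ^ 2 + z.im ^ 2 := by positivity

/-- The real part of `√(z² + w)` dominates `Re z √(1 + w/|z|²)`. -/
lemma mul_sqrt_le_complexDist_re {z : ℂ} (hz : 0 < z.re) {w : ℝ} (hw : 0 ≤ w) :
    z.re * √(1 + w / (z.re ^ 2 + z.im ^ 2)) ≤ (complexDist z w).re := by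
  have ha := complexDist_re_pos hz hw
  have h1 := complexDist_re_sq_sub z w
  have h2 := complexDist_re_mul_im z w
  set a := (complexDist z w).re
  set b := (complexDist z w).im
  set s := z.re
  set t := z.im
  have hN : 0 < s ^ 2 + t ^ 2 := normSq_pos_of_re_pos hz
  -- eliminating the imaginary part leaves `(a² - s²)(a² + t²) = a² w`
  have h3 : (a ^ 2 - s ^ 2) * (a ^ 2 + t ^ 2) = a ^ 2 * w := by
    have : a ^ 2 * b ^ 2 = s ^ 2 * t ^ 2 := by rw [← mul_pow, h2, mul_pow]
    linear_combination a ^ 2 * h1 + this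
  have hat : 0 < a ^ 2 + t ^ 2 := by positivity
  have h4 : s ^ 2 ≤ a ^ 2 := by
    by_contra hlt
    push Not at hlt
    have : (a ^ 2 - s ^ 2) * (a ^ 2 + t ^ 2) < 0 := mul_neg_of_neg_of_pos (by linarith) hat
    have : 0 ≤ a ^ 2 * w := by positivity
    linarith
  have h5 : s ^ 2 * (1 + w / (s ^ 2 + t ^ 2)) ≤ a ^ 2 := by
    have e : s ^ 2 * (1 + w / (s ^ 2 + t ^ 2)) = s ^ 2 + s ^ 2 * w / (s ^ 2 + t ^ 2) := by
      field_simp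
    have : s ^ 2 * w / (s ^ 2 + t ^ 2) ≤ a ^ 2 - s ^ 2 := by
      rw [div_le_iff₀ hN]
      have h6 : (a ^ 2 - s ^ 2) = a ^ 2 * w / (a ^ 2 + t ^ 2) := by
        rw [eq_div_iff hat.ne', h3]
      rw [h6, div_mul_eq_mul_div, le_div_iff₀ hat]
      have : 0 ≤ w * t ^ 2 * (a ^ 2 - s ^ 2) :=
        mul_nonneg (by positivity) (by linarith)
      nlinarith
    linarith
  rw [← abs_of_pos ha, ← Real.sqrt_sq_eq_abs]
  refine Real.le_sqrt_of_sq_le ?_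
  rwa [mul_pow, Real.sq_sqrt (by positivity)]

lemma re_le_complexDist_re {z : ℂ} (hz : 0 < z.re) {w : ℝ} (hw : 0 ≤ w) :
    z.re ≤ (complexDist z w).re := by
  refine le_trans ?_ (mul_sqrt_le_complexDist_re hz hw)
  refine le_mul_of_one_le_right hz.le ?_
  rw [Real.one_le_sqrt]
  have : 0 ≤ w / (z.re ^ 2 + z.im ^ 2) := by positivity
  linarith

lemma norm_exp_neg_div_complexDist_le {z : ℂ} (hz : 0 < z.re) {w : ℝ} (hw : 0 ≤ w) :
    ‖Complex.exp (-complexDist z w) / complexDist z w‖ ≤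
      Real.exp (-(complexDist z w).re) / (complexDist z w).re := by
  have h := complexDist_re_pos hz hw
  rw [norm_div, Complex.norm_exp, Complex.neg_re]
  exact div_le_div_of_nonneg_left (Real.exp_pos _).le h
    ((le_abs_self _).trans (Complex.abs_re_le_norm _))

lemma complexDist_ne_zero {z : ℂ} (hz : 0 < z.re) {w : ℝ} (hw : 0 ≤ w) : complexDist z w ≠ 0 :=
  fun h => (complexDist_re_pos hz hw).ne' (by simp [h])

lemma mem_slitPlane_of_re_pos {z : ℂ} (hz : 0 < z.re) {w : ℝ} (hw : 0 ≤ w) :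
    z ^ 2 + w ∈ Complex.slitPlane := by
  rw [Complex.mem_slitPlane_iff]
  by_cases h : z.im = 0
  · left
    simp [sq, h]
    positivity
  · right
    simp [sq]
    intro h0
    have : z.re * z.im = 0 := by linarith
    simp [hz.ne', h] at this

lemma differentiableAt_complexDist {z : ℂ} (hz : 0 < z.re) {w : ℝ} (hw : 0 ≤ w) :
    DifferentiableAt ℂ (fun z => complexDist z w) z := by
  unfold complexDist
  exact DifferentiableAt.cpow (by fun_prop) (by fun_prop) (mem_slitPlane_of_re_pos hz hw)

/-- Poisson summation for the kernel of `e^{-zΛ}/Λ`. Both sides are analytic in `z` on the right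
half-plane and agree on the positive half-line. -/
lemma tsum_torusChar_mul_exp {R : ℝ} (hR : 0 < R) {z : ℂ} (hz : 0 < z.re) (x : Fin 2 → ℝ) :
    ∑' n : Fin 2 → ℤ, torusChar R n (toTorus R x) *
        (Complex.exp (-(z * lambdaSymbol (freq R n))) / lambdaSymbol (freq R n)) =
      ((R ^ 2 / (2 * Real.pi) : ℝ) : ℂ) * ∑' m : Fin 2 → ℤ,
        Complex.exp (-complexDist z (distSq R x m)) / complexDist z (distSq R x m) := by
  set δ := z.re / 2
  set M := ‖z‖ + 1
  have hδ : 0 < δ := half_pos hz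
  have hM : 0 < M := by positivity
  set U : Set ℂ := {w | δ < w.re} ∩ Metric.ball 0 M with hU
  have hUo : IsOpen U := (isOpen_lt continuous_const Complex.continuous_re).inter Metric.isOpen_ball
  have hUc : Convex ℝ U := (convex_halfSpace_re_gt δ).inter (convex_ball 0 M)
  have hzU : z ∈ U := ⟨half_lt_self hz, by simp [M]⟩
  have hreU : (z.re : ℂ) ∈ U := by
    refine ⟨half_lt_self hz, ?_⟩
    rw [mem_ball_zero_iff, Complex.norm_real, Real.norm_of_nonneg hz.le]
    linarith [Complex.re_le_norm z]
  have hUre : ∀ w ∈ U, 0 < w.re := fun w hw => hδ.trans hw.1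
  have hΛ1 : ∀ n, 1 ≤ lambdaSymbol (freq R n) := fun n => one_le_lambdaSymbol _
  have hΛ0 : ∀ n, 0 < lambdaSymbol (freq R n) := fun n => one_pos.trans_le (hΛ1 n)
  have d1 : DifferentiableOn ℂ (fun z : ℂ => ∑' n : Fin 2 → ℤ, torusChar R n (toTorus R x) *
      (Complex.exp (-(z * lambdaSymbol (freq R n))) / lambdaSymbol (freq R n))) U := by
    refine Complex.differentiableOn_tsum_of_summable_norm (summable_exp_neg_lambdaSymbol hR hδ)
      (fun n => ?_) hUo fun n w hw => ?_
    · fun_prop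
    · rw [norm_mul, norm_torusChar, one_mul, norm_div, Complex.norm_exp, Complex.norm_real,
        Real.norm_of_nonneg (hΛ0 n).le]
      refine (div_le_self (Real.exp_pos _).le (hΛ1 n)).trans (Real.exp_le_exp.2 ?_)
      rw [Complex.neg_re, Complex.re_mul_ofReal]
      exact neg_le_neg (mul_le_mul_of_nonneg_right (le_of_lt hw.1) (hΛ0 n).le)
  have d2 : DifferentiableOn ℂ (fun z : ℂ => ((R ^ 2 / (2 * Real.pi) : ℝ) : ℂ) *
      ∑' m : Fin 2 → ℤ, Complex.exp (-complexDist z (distSq R x m)) /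
        complexDist z (distSq R x m)) U := by
    refine DifferentiableOn.const_mul ?_ _
    refine Complex.differentiableOn_tsum_of_summable_norm
      ((summable_exp_neg_sqrt hδ hR hM x).mul_right δ⁻¹) (fun m w hw => ?_) hUo fun m w hw => ?_
    · have h := differentiableAt_complexDist (hUre w hw) (distSq_nonneg R x m)
      exact (h.neg.cexp.div h
        (complexDist_ne_zero (hUre w hw) (distSq_nonneg R x m))).differentiableWithinAt
    · have hw0 := hUre w hw
      have hd := distSq_nonneg R x m
      refine (norm_exp_neg_div_complexDist_le hw0 hd).trans ?_
      have h1 := mul_sqrt_le_complexDist_re hw0 hd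
      have h2 := re_le_complexDist_re hw0 hd
      have hwδ : δ ≤ w.re := le_of_lt hw.1
      have hwM : w.re ^ 2 + w.im ^ 2 ≤ M ^ 2 := by
        have h3 : ‖w‖ ≤ M := (mem_ball_zero_iff.1 hw.2).le
        have h4 := Complex.sq_norm w
        rw [Complex.normSq_apply] at h4
        nlinarith [norm_nonneg w]
      rw [← div_eq_mul_inv]
      refine div_le_div₀ (Real.exp_pos _).le (Real.exp_le_exp.2 (neg_le_neg ?_)) hδ
        (hwδ.trans h2)
      refine le_trans ?_ h1
      refine mul_le_mul hwδ (Real.sqrt_le_sqrt ?_) (Real.sqrt_nonneg _) hw0.le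
      have := div_le_div_of_nonneg_left hd (normSq_pos_of_re_pos hw0) hwM
      linarith
  refine (d1.analyticOnNhd hUo).eqOn_of_preconnected_of_frequently_eq (d2.analyticOnNhd hUo)
    hUc.isPreconnected hreU ?_ hzU
  -- the positive reals accumulate at `Re z`
  have htend : Tendsto (fun s : ℝ => (s : ℂ)) (𝓝[≠] z.re) (𝓝[≠] (z.re : ℂ)) := by
    refine tendsto_nhdsWithin_of_tendsto_nhds_of_eventually_within _
      (Complex.continuous_ofReal.tendsto _ |>.mono_left nhdsWithin_le_nhds) ?_
    filter_upwards [self_mem_nhdsWithin] with s hs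
    simpa using hs
  refine htend.frequently (Eventually.frequently ?_)
  filter_upwards [nhdsWithin_le_nhds (lt_mem_nhds hz)] with s hs
  have h := tsum_torusChar_mul_exp_real hR hs x
  convert h using 3
  · push_cast; rfl
  · funext m
    rw [complexDist_ofReal (distSq_nonneg R x m)]
    push_cast; rfl

/-! ### Decay of the kernel off the light cone -/

/-- Decay of the kernel of `e^{-(s+it)Λ}/Λ`. Near the light cone both `Re r` and `Im r` enter,
through `Re r · Im r = st`; far outside the cone `Re r` is comparable to the distance. -/
lemma norm_exp_neg_div_complexDist_le_latticeWeight {R s t : ℝ} (hs : 0 < s) (hs1 : s ≤ 1)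
    (ht : 1 ≤ t) (x : Fin 2 → ℝ) (m : Fin 2 → ℤ) :
    ‖Complex.exp (-complexDist (s + t * Complex.I) (distSq R x m)) /
        complexDist (s + t * Complex.I) (distSq R x m)‖ ≤
      80 * (s * t)⁻¹ * latticeWeight R t x m := by
  have ht0 : 0 < t := one_pos.trans_le ht
  set z : ℂ := s + t * Complex.I with hz
  have hre : z.re = s := by simp [hz]
  have him : z.im = t := by simp [hz]
  have hz0 : 0 < z.re := by rwa [hre]
  set w := distSq R x m with hw
  have hw0 : 0 ≤ w := distSq_nonneg R x m
  have ha := complexDist_re_pos hz0 hw0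
  have h1 := complexDist_re_sq_sub z w
  have h2 := complexDist_re_mul_im z w
  rw [hre, him] at h1 h2
  have hnim := Complex.abs_im_le_norm (complexDist z w)
  have hn0 := norm_pos_iff.2 (complexDist_ne_zero hz0 hw0)
  have hB := norm_exp_neg_div_complexDist_le hz0 hw0
  -- the weight is at least `(1 + w/t²)⁻²`
  have hW : ((1 + w / t ^ 2) ^ 2)⁻¹ ≤ latticeWeight R t x m := by
    rw [latticeWeight, ← mul_inv]
    refine inv_anti₀ (by positivity) ?_
    rw [hw, distSq, add_div, ← div_pow, ← div_pow]
    set p := ((x 0 - R * m 0) / t) ^ 2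
    set q := ((x 1 - R * m 1) / t) ^ 2
    have hp : 0 ≤ p := sq_nonneg _
    have hq : 0 ≤ q := sq_nonneg _
    nlinarith [mul_nonneg hp hq]
  refine le_trans ?_ (mul_le_mul_of_nonneg_left hW (by positivity))
  set a := (complexDist z w).re
  set b := (complexDist z w).im
  rcases le_total w (4 * t ^ 2) with hwt | hwt
  · -- inside and near the cone: `e^{-a}/|r| ≤ a⁻¹ b⁻¹ = (st)⁻¹`
    have hb : 0 < b := by
      by_contra hb
      push Not at hb
      have : a * b ≤ 0 := mul_nonpos_of_nonneg_of_nonpos ha.le hb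
      have : 0 < s * t := by positivity
      linarith
    have h3 : ‖Complex.exp (-complexDist z w) / complexDist z w‖ ≤ (s * t)⁻¹ := by
      rw [norm_div, Complex.norm_exp, Complex.neg_re, ← h2, mul_inv]
      rw [div_eq_mul_inv, Real.exp_neg]
      refine mul_le_mul (inv_anti₀ ha ?_) (inv_anti₀ hb ((le_abs_self _).trans hnim))
        (by positivity) (by positivity)
      linarith [Real.add_one_le_exp a]
    refine h3.trans ?_
    rw [mul_comm 80, mul_assoc]
    refine le_mul_of_one_le_right (by positivity) ?_
    rw [← div_eq_mul_inv, one_le_div (by positivity)]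
    have : w / t ^ 2 ≤ 4 := by rwa [div_le_iff₀ (by positivity)]
    have : 0 ≤ w / t ^ 2 := by positivity
    nlinarith
  · -- outside the cone: `a² ≥ 3w/4`, and `e^a ≥ a⁴/24` absorbs the weight
    refine hB.trans ?_
    have h3 : 3 / 4 * w ≤ a ^ 2 := by nlinarith [sq_nonneg b]
    have h4 : t ≤ a := by
      refine le_of_sq_le_sq ?_ ha.le
      nlinarith
    have h5 := Real.pow_div_factorial_le_exp a ha.le 4
    norm_num [Nat.factorial] at h5
    have h6 : (1 + w / t ^ 2) ^ 2 ≤ 25 / 16 * (w / t ^ 2) ^ 2 := by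
      have : 4 ≤ w / t ^ 2 := by rwa [le_div_iff₀ (by positivity)]
      nlinarith
    have h7 : (w / t ^ 2) ^ 2 ≤ w ^ 2 := by
      rw [div_pow]
      exact div_le_self (sq_nonneg w) (one_le_pow₀ (one_le_pow₀ ht))
    have h8 : 9 / 16 * w ^ 2 ≤ a ^ 4 := by nlinarith
    have h9 : (1 + w / t ^ 2) ^ 2 ≤ 80 * Real.exp a := by linarith [Real.exp_pos a]
    rw [Real.exp_neg, div_eq_mul_inv, mul_assoc, ← mul_inv, ← mul_inv, ← div_eq_mul_inv,
      inv_eq_one_div, div_le_div_iff₀ (by positivity) (by positivity), one_mul]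
    have hst : s * t ≤ a := by nlinarith
    calc s * t * (1 + w / t ^ 2) ^ 2 ≤ a * (80 * Real.exp a) := by
          exact mul_le_mul hst h9 (by positivity) ha.le
      _ = 80 * (Real.exp a * a) := by ring

/-- The sup bound for the torus kernel of `e^{-(s+it)Λ}/Λ`. -/
lemma norm_tsum_torusChar_mul_exp_le {R s t : ℝ} (hR : 0 < R) (hs : 0 < s) (hs1 : s ≤ 1)
    (ht : 1 ≤ t) (x : Fin 2 → ℝ) :
    ‖∑' n : Fin 2 → ℤ, torusChar R n (toTorus R x) *
        (Complex.exp (-((s + t * Complex.I) * lambdaSymbol (freq R n))) /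
          lambdaSymbol (freq R n))‖ ≤
      R ^ 2 * (640 / 3 * (s * t)⁻¹ * (t / R + 1) ^ 2) := by
  have ht0 : 0 < t := one_pos.trans_le ht
  have hpi := Real.pi_gt_three
  rw [tsum_torusChar_mul_exp hR (by simpa using hs), norm_mul, Complex.norm_real,
    Real.norm_of_nonneg (by positivity)]
  have h := tsum_of_norm_bounded
    (((summable_latticeWeight hR ht0 x).hasSum).mul_left (80 * (s * t)⁻¹))
    (norm_exp_neg_div_complexDist_le_latticeWeight (R := R) hs hs1 ht x)
  have h2 := tsum_latticeWeight_le hR ht0 x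
  calc _ ≤ R ^ 2 / (2 * Real.pi) * (80 * (s * t)⁻¹ * (16 * (t / R + 1) ^ 2)) := by
        refine mul_le_mul_of_nonneg_left (h.trans ?_) (by positivity)
        exact mul_le_mul_of_nonneg_left h2 (by positivity)
    _ ≤ R ^ 2 / 6 * (80 * (s * t)⁻¹ * (16 * (t / R + 1) ^ 2)) := by
        refine mul_le_mul_of_nonneg_right ?_ (by positivity)
        exact div_le_div_of_nonneg_left (by positivity) (by norm_num) (by linarith)
    _ = _ := by ring

/-! ### Multipliers with Schwartz symbols -/

/-- The Euclidean plane of frequencies. -/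
abbrev Plane : Type := EuclideanSpace ℝ (Fin 2)

/-- The `L¹` norm of the Fourier transform is controlled by finitely many Schwartz seminorms. -/
lemma exists_integral_norm_fourier_le :
    ∃ (s : Finset (ℕ × ℕ)) (C : ℝ), 0 ≤ C ∧ ∀ f : 𝓢(Plane, ℂ),
      ∫ y, ‖𝓕 f y‖ ≤ C * s.sup (schwartzSeminormFamily ℂ Plane ℂ) f := by
  set T : 𝓢(Plane, ℂ) →L[ℂ] Lp ℂ 1 (volume : Measure Plane) :=
    (SchwartzMap.toLpCLM ℂ ℂ 1 volume).comp (SchwartzMap.fourierTransformCLM ℂ) with hT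
  obtain ⟨s, C, -, hC⟩ := Seminorm.bound_of_continuous (schwartz_withSeminorms ℂ Plane ℂ)
    ((normSeminorm ℂ (Lp ℂ 1 (volume : Measure Plane))).comp T.toLinearMap)
    (continuous_norm.comp T.continuous)
  refine ⟨s, C, C.2, fun f => ?_⟩
  have h := hC f
  have e : ∫ y, ‖𝓕 f y‖ = ‖T f‖ := by
    simp only [hT, ContinuousLinearMap.comp_apply, SchwartzMap.toLpCLM_apply,
      SchwartzMap.fourierTransformCLM_apply]
    rw [SchwartzMap.norm_toLp_one]
  rw [e]
  exact h

/-- A smooth family, over a compact parameter interval, of functions supported in a fixed ball has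
Fourier transforms bounded in `L¹`. -/
lemma exists_integral_norm_fourier_family_le {F : ℝ × Plane → ℂ} (hF : ContDiff ℝ ∞ F) {ρ : ℝ}
    (hρ : ∀ ε η, ρ ≤ ‖η‖ → F (ε, η) = 0) :
    ∃ C : ℝ, ∀ ε ∈ Icc (0 : ℝ) 1, ∃ f : 𝓢(Plane, ℂ), (∀ η, f η = F (ε, η)) ∧
      ∫ y, ‖𝓕 f y‖ ≤ C := by
  obtain ⟨s, C, hC0, hC⟩ := exists_integral_norm_fourier_le
  have hK : IsCompact (Icc (0 : ℝ) 1 ×ˢ Metric.closedBall (0 : Plane) ρ) :=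
    isCompact_Icc.prod (isCompact_closedBall 0 ρ)
  have hb : ∀ i : ℕ × ℕ, ∃ B : ℝ, 0 ≤ B ∧ ∀ p ∈ Icc (0 : ℝ) 1 ×ˢ Metric.closedBall (0 : Plane) ρ,
      ‖p.2‖ ^ i.1 * (‖iteratedFDeriv ℝ i.2 F p‖ *
        ‖ContinuousLinearMap.inr ℝ ℝ Plane‖ ^ i.2) ≤ B := by
    intro i
    have hcont : Continuous fun p : ℝ × Plane => ‖p.2‖ ^ i.1 * (‖iteratedFDeriv ℝ i.2 F p‖ *
        ‖ContinuousLinearMap.inr ℝ ℝ Plane‖ ^ i.2) := by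
      have := hF.continuous_iteratedFDeriv (m := i.2) (mod_cast le_top)
      fun_prop
    obtain ⟨B, hB⟩ := (hK.image hcont).bddAbove
    exact ⟨max B 0, le_max_right _ _,
      fun p hp => le_max_of_le_left (hB (mem_image_of_mem _ hp))⟩
  choose B hB0 hB using hb
  refine ⟨C * ∑ i ∈ s, B i, fun ε hε => ?_⟩
  have hsm : ContDiff ℝ ∞ fun η : Plane => F (ε, η) := by fun_prop
  have hcs : HasCompactSupport fun η : Plane => F (ε, η) := by
    refine HasCompactSupport.intro (isCompact_closedBall (0 : Plane) ρ) fun η hη => hρ ε η ?_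
    rw [mem_closedBall_zero_iff, not_le] at hη
    exact hη.le
  refine ⟨hcs.toSchwartzMap hsm, fun η => rfl, (hC _).trans ?_⟩
  refine mul_le_mul_of_nonneg_left ?_ hC0
  refine Seminorm.finset_sup_apply_le (Finset.sum_nonneg fun i _ => hB0 i) fun i hi => ?_
  refine le_trans ?_ (Finset.single_le_sum (f := B) (fun i _ => hB0 i) hi)
  refine SchwartzMap.seminorm_le_bound _ _ _ _ (hB0 i) fun η => ?_
  change ‖η‖ ^ i.1 * ‖iteratedFDeriv ℝ i.2 (fun η : Plane => F (ε, η)) η‖ ≤ B i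
  by_cases hη : ‖η‖ ≤ ρ
  · refine le_trans ?_ (hB i (ε, η) ⟨hε, by simpa using hη⟩)
    refine mul_le_mul_of_nonneg_left ?_ (by positivity)
    -- the slice is `F` precomposed with the affine map `η ↦ (ε, 0) + (0, η)`
    have e : (fun η : Plane => F (ε, η)) =
        (fun p => F ((ε, 0) + p)) ∘ ContinuousLinearMap.inr ℝ ℝ Plane := by
      funext η; simp
    have hg : ContDiff ℝ i.2 fun p : ℝ × Plane => F ((ε, 0) + p) :=
      (hF.of_le (mod_cast le_top)).comp (by fun_prop)
    rw [e, ContinuousLinearMap.iteratedFDeriv_comp_right _ hg _ le_rfl,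
      iteratedFDeriv_comp_add_left]
    refine (ContinuousMultilinearMap.norm_compContinuousLinearMap_le _ _).trans ?_
    simp
  · push Not at hη
    have hev : (fun η : Plane => F (ε, η)) =ᶠ[𝓝 η] fun _ => 0 := by
      filter_upwards [(isOpen_lt continuous_const continuous_norm).mem_nhds hη] with η' h
      exact hρ ε η' (le_of_lt h)
    have := (hev.iteratedFDeriv ℝ i.2).eq_of_nhds
    rw [this]
    simpa using hB0 i

lemma torusChar_toTorus_add (R : ℝ) (n : Fin 2 → ℤ) (x : Fin 2 → ℝ) (c : ℝ) (y : Plane) :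
    torusChar R n (toTorus R fun j => x j + 2 * Real.pi * c * y j) =
      torusChar R n (toTorus R x) * (Real.fourierChar (inner ℝ y (c • freq R n)) : ℂ) := by
  simp only [torusChar_eq_mul, toTorus, fourier_coe_apply, Real.fourierChar_apply,
    ← Complex.exp_add]
  congr 1
  simp [freq, PiLp.inner_apply, Fin.sum_univ_two]
  ring

lemma continuous_torusChar (R : ℝ) (n : Fin 2 → ℤ) : Continuous (torusChar R n) := by
  unfold torusChar
  fun_prop

lemma continuous_toTorus (R : ℝ) : Continuous (toTorus R) :=
  continuous_pi fun j => (AddCircle.continuous_mk' R).comp (continuous_apply j)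

/-- Transference: a Fourier series multiplied by `f(cξ)` is an average of translates, with weight
the Fourier transform of `f`, so its sup norm grows at most by the factor `‖𝓕 f‖₁`. -/
lemma norm_tsum_schwartz_mul_le {R : ℝ} (f : 𝓢(Plane, ℂ)) (c : ℝ) {G : (Fin 2 → ℤ) → ℂ}
    (hG : Summable fun n => ‖G n‖) {S : ℝ}
    (hS : ∀ x, ‖∑' n, torusChar R n (toTorus R x) * G n‖ ≤ S) (x : Fin 2 → ℝ) :
    ‖∑' n, torusChar R n (toTorus R x) * (f (c • freq R n) * G n)‖ ≤ (∫ y, ‖𝓕 f y‖) * S := by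
  have hint : Integrable (fun y => 𝓕 f y) := (𝓕 f).integrable
  set X : Plane → Fin 2 → ℝ := fun y j => x j + 2 * Real.pi * c * y j with hX
  have hXc : Continuous X := by fun_prop
  set H : (Fin 2 → ℤ) → Plane → ℂ := fun n y => (torusChar R n (toTorus R (X y)) * G n) * 𝓕 f y
    with hH
  have hn : ∀ n y, ‖H n y‖ = ‖G n‖ * ‖𝓕 f y‖ := fun n y => by
    rw [hH, norm_mul, norm_mul, norm_torusChar, one_mul]
  have hHI : ∀ n, Integrable (H n) := by
    intro n
    refine hint.bdd_mul (c := ‖G n‖) ?_ (Eventually.of_forall fun y => ?_)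
    · exact (((continuous_torusChar R n).comp ((continuous_toTorus R).comp hXc)).mul
        continuous_const).aestronglyMeasurable
    · rw [norm_mul, norm_torusChar, one_mul]
  have hHs : Summable fun n => ∫ y, ‖H n y‖ := by
    simp only [hn, integral_const_mul]
    exact hG.mul_right _
  have hinv : ∀ η, f η = ∫ y, (Real.fourierChar (inner ℝ y η) : ℂ) * 𝓕 f y := by
    intro η
    have h1 : 𝓕⁻ (𝓕 f) = f := FourierTransform.fourierInv_fourier_eq f
    conv_lhs => rw [← h1]
    rw [SchwartzMap.fourierInv_coe, Real.fourierInv_eq]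
    rfl
  have hHi : ∀ n, ∫ y, H n y = torusChar R n (toTorus R x) * (f (c • freq R n) * G n) := by
    intro n
    rw [hinv, ← integral_mul_const, ← integral_const_mul]
    refine integral_congr_ae (Eventually.of_forall fun y => ?_)
    simp only [hH, hX]
    rw [torusChar_toTorus_add]
    ring
  have hsum := (hasSum_integral_of_summable_integral_norm hHI hHs).tsum_eq
  simp only [hHi] at hsum
  rw [hsum, ← integral_mul_const]
  refine norm_integral_le_of_norm_le (hint.norm.mul_const S) (Eventually.of_forall fun y => ?_)
  simp only [hH]
  rw [tsum_mul_right, norm_mul, mul_comm]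
  exact mul_le_mul_of_nonneg_left (hS _) (norm_nonneg _)

/-! ### The Littlewood–Paley symbols -/

variable {φ : Plane → ℝ}

lemma lpSymbol_eq (φ : Plane → ℝ) (k : ℤ) (ξ : Plane) :
    lpSymbol φ k ξ = lpSymbol φ 0 (((2 : ℝ) ^ k)⁻¹ • ξ) := by
  have : ((2 : ℝ) ^ (k - 1))⁻¹ = ((2 : ℝ) ^ (0 - 1 : ℤ))⁻¹ * ((2 : ℝ) ^ k)⁻¹ := by
    rw [← mul_inv, ← zpow_add₀ two_ne_zero]
    congr 2
    ring
  simp only [lpSymbol, this, mul_smul]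
  simp

lemma contDiff_lpSymbol_zero (hφ : IsCutoff φ) : ContDiff ℝ ∞ (lpSymbol φ 0) := by
  have := hφ.smooth
  unfold lpSymbol
  fun_prop

lemma lpSymbol_zero_eq_zero_of_lt (hφ : IsCutoff φ) {η : Plane} (h : ‖η‖ < 1 / 3) :
    lpSymbol φ 0 η = 0 := by
  rw [lpSymbol, hφ.eq_one _ ?_, hφ.eq_one _ ?_, sub_self]
  · rw [mem_ball_zero_iff, norm_smul]
    norm_num
    linarith
  · rw [mem_ball_zero_iff, norm_smul]
    norm_num
    linarith [norm_nonneg η]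

lemma lpSymbol_zero_eq_zero_of_le (hφ : IsCutoff φ) {η : Plane} (h : 3 / 2 ≤ ‖η‖) :
    lpSymbol φ 0 η = 0 := by
  rw [lpSymbol, hφ.eq_zero _ ?_, hφ.eq_zero _ ?_, sub_self]
  · rw [mem_ball_zero_iff, norm_smul, not_lt]
    norm_num
    linarith
  · rw [mem_ball_zero_iff, norm_smul, not_lt]
    norm_num
    linarith

lemma exists_abs_lpSymbol_le (hφ : IsCutoff φ) : ∃ B : ℝ, 0 < B ∧ ∀ k ξ, |lpSymbol φ k ξ| ≤ B := by
  have hcs : HasCompactSupport (lpSymbol φ 0) := by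
    refine HasCompactSupport.intro (isCompact_closedBall (0 : Plane) (3 / 2)) fun η hη => ?_
    rw [mem_closedBall_zero_iff, not_le] at hη
    exact lpSymbol_zero_eq_zero_of_le hφ hη.le
  obtain ⟨B, hB⟩ := hcs.exists_bound_of_continuous (contDiff_lpSymbol_zero hφ).continuous
  refine ⟨max B 1, by positivity, fun k ξ => ?_⟩
  rw [lpSymbol_eq]
  exact le_max_of_le_left (hB _)

/-- The high-frequency symbols `φ₀(η) r eʳ` with `r = √(ε² + |η|²)`, a smooth family up to `ε = 0`
since `φ₀` vanishes near the origin. -/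
lemma contDiff_highFrequencySymbol (hφ : IsCutoff φ) :
    ContDiff ℝ ∞ fun p : ℝ × Plane => ((lpSymbol φ 0 p.2 *
      (√(p.1 ^ 2 + ‖p.2‖ ^ 2) * Real.exp √(p.1 ^ 2 + ‖p.2‖ ^ 2)) : ℝ) : ℂ) := by
  refine Complex.ofRealCLM.contDiff.comp (contDiff_iff_contDiffAt.2 fun p => ?_)
  by_cases hp : ‖p.2‖ < 1 / 3
  · refine (contDiffAt_const (c := (0 : ℝ))).congr_of_eventuallyEq ?_
    filter_upwards [(isOpen_lt (continuous_norm.comp continuous_snd)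
      continuous_const).mem_nhds hp] with q hq
    rw [lpSymbol_zero_eq_zero_of_lt hφ hq]
    exact zero_mul _
  · have hp2 : p.1 ^ 2 + ‖p.2‖ ^ 2 ≠ 0 := by
      push Not at hp
      have : 0 < ‖p.2‖ := by linarith
      positivity
    have h1 : ContDiffAt ℝ ∞ (fun p : ℝ × Plane => √(p.1 ^ 2 + ‖p.2‖ ^ 2)) p := by
      refine ContDiffAt.sqrt ?_ hp2
      exact ((contDiff_fst.pow 2).add ((contDiff_norm_sq ℝ).comp contDiff_snd)).contDiffAt
    have h2 := ((contDiff_lpSymbol_zero hφ).comp (contDiff_snd (E := ℝ))).contDiffAt (x := p)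
    exact h2.mul (h1.mul h1.exp)

/-- The low-frequency symbols `φ₀(η) r eʳ` with `r = √(1 + δ²|η|²)`. -/
lemma contDiff_lowFrequencySymbol (hφ : IsCutoff φ) :
    ContDiff ℝ ∞ fun p : ℝ × Plane => ((lpSymbol φ 0 p.2 *
      (√(1 + p.1 ^ 2 * ‖p.2‖ ^ 2) * Real.exp √(1 + p.1 ^ 2 * ‖p.2‖ ^ 2)) : ℝ) : ℂ) := by
  refine Complex.ofRealCLM.contDiff.comp ?_
  have h1 : ContDiff ℝ ∞ (fun p : ℝ × Plane => √(1 + p.1 ^ 2 * ‖p.2‖ ^ 2)) := by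
    refine ContDiff.sqrt ?_ fun p => by positivity
    exact contDiff_const.add ((contDiff_fst.pow 2).mul ((contDiff_norm_sq ℝ).comp contDiff_snd))
  have h2 := (contDiff_lpSymbol_zero hφ).comp (contDiff_snd (E := ℝ))
  exact h2.mul (h1.mul h1.exp)

/-- The symbol `φ_k · sΛ e^{sΛ}` with `s = 2^{-k⁺}` is the dilate by `2^k` of a Schwartz function
whose Fourier transform has an `L¹` norm bounded independently of `k`. -/
lemma exists_schwartz_symbol (hφ : IsCutoff φ) :
    ∃ C : ℝ, ∀ k : ℤ, ∃ f : 𝓢(Plane, ℂ), ∫ y, ‖𝓕 f y‖ ≤ C ∧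
      ∀ ξ : Plane, f (((2 : ℝ) ^ k)⁻¹ • ξ) = ((lpSymbol φ k ξ *
        (((2 : ℝ) ^ max k 0)⁻¹ * lambdaSymbol ξ *
          Real.exp (((2 : ℝ) ^ max k 0)⁻¹ * lambdaSymbol ξ)) : ℝ) : ℂ) := by
  obtain ⟨C₁, h₁⟩ := exists_integral_norm_fourier_family_le (contDiff_highFrequencySymbol hφ)
    (ρ := 3 / 2) (fun ε η h => by simp [lpSymbol_zero_eq_zero_of_le hφ h])
  obtain ⟨C₂, h₂⟩ := exists_integral_norm_fourier_family_le (contDiff_lowFrequencySymbol hφ)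
    (ρ := 3 / 2) (fun ε η h => by simp [lpSymbol_zero_eq_zero_of_le hφ h])
  refine ⟨max C₁ C₂, fun k => ?_⟩
  have h2k : (0 : ℝ) < 2 ^ k := by positivity
  rcases le_total 0 k with hk | hk
  · obtain ⟨f, hf, hfC⟩ := h₁ ((2 : ℝ) ^ k)⁻¹
      ⟨by positivity, inv_le_one_of_one_le₀ (one_le_zpow₀ one_le_two hk)⟩
    refine ⟨f, hfC.trans (le_max_left _ _), fun ξ => ?_⟩
    have e : √((((2 : ℝ) ^ k)⁻¹) ^ 2 + ‖((2 : ℝ) ^ k)⁻¹ • ξ‖ ^ 2) =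
        ((2 : ℝ) ^ k)⁻¹ * lambdaSymbol ξ := by
      rw [norm_smul, Real.norm_of_nonneg (by positivity), mul_pow, ← mul_one_add,
        Real.sqrt_mul (by positivity), Real.sqrt_sq (by positivity), lambdaSymbol]
    rw [hf, max_eq_left hk, lpSymbol_eq φ k]
    simp only [e]
  · obtain ⟨f, hf, hfC⟩ := h₂ ((2 : ℝ) ^ k) ⟨by positivity, zpow_le_one_of_nonpos₀ one_le_two hk⟩
    refine ⟨f, hfC.trans (le_max_right _ _), fun ξ => ?_⟩
    have e : √(1 + ((2 : ℝ) ^ k) ^ 2 * ‖((2 : ℝ) ^ k)⁻¹ • ξ‖ ^ 2) = lambdaSymbol ξ := by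
      rw [norm_smul, Real.norm_of_nonneg (by positivity), mul_pow, ← mul_assoc, ← mul_pow,
        mul_inv_cancel₀ h2k.ne', one_pow, one_mul, lambdaSymbol]
    rw [hf, max_eq_right hk, lpSymbol_eq φ k]
    simp only [e]
    simp

/-! ### The dispersive bound for the kernel -/

/-- The symbol of `P_k e^{-itΛ}`. -/
def kleinGordonSymbol (φ : Plane → ℝ) (k : ℤ) (t : ℝ) (ξ : Plane) : ℂ :=
  (lpSymbol φ k ξ : ℂ) * Complex.exp (-Complex.I * (t : ℂ) * (lambdaSymbol ξ : ℂ))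

lemma norm_kleinGordonSymbol (φ : Plane → ℝ) (k : ℤ) (t : ℝ) (ξ : Plane) :
    ‖kleinGordonSymbol φ k t ξ‖ = |lpSymbol φ k ξ| := by
  rw [kleinGordonSymbol, norm_mul, Complex.norm_real, Complex.norm_exp]
  simp

/-- The frequencies in the support of `φ_k`, as a square of side `O(2^k R)`. -/
def freqBox (R : ℝ) (k : ℤ) : Finset (Fin 2 → ℤ) :=
  Fintype.piFinset fun _ => Finset.Icc (-(⌊(2 : ℝ) ^ k * R⌋₊ : ℤ)) ⌊(2 : ℝ) ^ k * R⌋₊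

lemma kleinGordonSymbol_eq_zero (hφ : IsCutoff φ) {R : ℝ} (hR : 0 < R) (k : ℤ) (t : ℝ)
    {n : Fin 2 → ℤ} (hn : n ∉ freqBox R k) : kleinGordonSymbol φ k t (freq R n) = 0 := by
  have h2k : (0 : ℝ) < 2 ^ k := by positivity
  have hpi := Real.pi_gt_three
  suffices h : 3 / 2 ≤ ‖((2 : ℝ) ^ k)⁻¹ • freq R n‖ by
    rw [kleinGordonSymbol, lpSymbol_eq, lpSymbol_zero_eq_zero_of_le hφ h]
    simp
  by_contra h
  push Not at h
  apply hn
  rw [norm_smul, Real.norm_of_nonneg (by positivity), inv_mul_lt_iff₀ h2k] at h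
  rw [freqBox, Fintype.mem_piFinset]
  intro j
  have hj : |2 * Real.pi * n j / R| ≤ ‖freq R n‖ := by
    have := PiLp.norm_apply_le (freq R n) j
    simpa only [freq, Real.norm_eq_abs] using this
  have h3 : |(n j : ℝ)| ≤ 2 ^ k * R := by
    rw [abs_div, abs_mul, abs_of_pos hR, abs_of_pos (by positivity : 0 < 2 * Real.pi),
      div_le_iff₀ hR] at hj
    have : ‖freq R n‖ * R ≤ 2 ^ k * (3 / 2) * R := mul_le_mul_of_nonneg_right h.le hR.le
    have : 0 ≤ |(n j : ℝ)| := abs_nonneg _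
    have : 0 < 2 ^ k * R := by positivity
    nlinarith
  have h4 : (n j).natAbs ≤ ⌊(2 : ℝ) ^ k * R⌋₊ := by
    refine Nat.le_floor ?_
    rwa [Nat.cast_natAbs, Int.cast_abs]
  rw [Finset.mem_Icc]
  omega

/-- The trivial bound, by counting frequencies; it survives when `2^k R` is small because the zero
frequency does not contribute. -/
lemma exists_norm_kernel_le_trivial (hφ : IsCutoff φ) : ∃ B : ℝ, 0 < B ∧
    ∀ (R : ℝ) (_ : 0 < R) (k : ℤ) (t : ℝ) (x : Torus R),
      ‖∑' n, torusChar R n x * kleinGordonSymbol φ k t (freq R n)‖ ≤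
        R ^ 2 * (B * (2 : ℝ) ^ (2 * max k 0)) := by
  obtain ⟨B, hB0, hB⟩ := exists_abs_lpSymbol_le hφ
  refine ⟨9 * B, by positivity, fun R hR k t x => ?_⟩
  have hz : ∀ n ∉ freqBox R k, torusChar R n x * kleinGordonSymbol φ k t (freq R n) = 0 :=
    fun n hn => by rw [kleinGordonSymbol_eq_zero hφ hR k t hn, mul_zero]
  rw [tsum_eq_sum hz]
  set N := ⌊(2 : ℝ) ^ k * R⌋₊ with hN
  rcases Nat.eq_zero_or_pos N with h0 | h0
  · rw [Finset.sum_eq_zero, norm_zero]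
    · positivity
    · intro n hn
      have : n = 0 := by
        rw [freqBox, Fintype.mem_piFinset] at hn
        funext j
        have := hn j
        rw [← hN, h0, Finset.mem_Icc] at this
        simp only [Pi.zero_apply]
        omega
      have hf : freq R n = 0 := by
        rw [this]
        ext j
        simp [freq]
      rw [kleinGordonSymbol, hf, lpSymbol_eq, lpSymbol_zero_eq_zero_of_lt hφ (by simp)]
      simp
  · have hcard : ((freqBox R k).card : ℝ) ≤ 9 * ((2 : ℝ) ^ k * R) ^ 2 := by
      have h1 : (freqBox R k).card = (2 * N + 1) ^ 2 := by
        rw [freqBox, Fintype.card_piFinset_const, Int.card_Icc, ← hN]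
        congr 1
        omega
      have h2 : (N : ℝ) ≤ 2 ^ k * R := Nat.floor_le (by positivity)
      have h3 : (1 : ℝ) ≤ N := by exact_mod_cast h0
      rw [h1]
      push_cast
      nlinarith
    have hterm : ∀ n ∈ freqBox R k,
        ‖torusChar R n x * kleinGordonSymbol φ k t (freq R n)‖ ≤ B := fun n _ => by
      rw [norm_mul, norm_torusChar, one_mul, norm_kleinGordonSymbol]
      exact hB k _
    refine (norm_sum_le_of_le _ hterm).trans ?_
    rw [Finset.sum_const, nsmul_eq_mul]
    have h4 : ((2 : ℝ) ^ k) ^ 2 ≤ (2 : ℝ) ^ (2 * max k 0) := by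
      rw [← zpow_natCast, ← zpow_mul]
      refine zpow_le_zpow_right₀ one_le_two ?_
      push_cast
      have := le_max_left k 0
      omega
    calc (freqBox R k).card * B ≤ 9 * ((2 : ℝ) ^ k * R) ^ 2 * B :=
          mul_le_mul_of_nonneg_right hcard hB0.le
      _ = R ^ 2 * (9 * B * ((2 : ℝ) ^ k) ^ 2) := by ring
      _ ≤ _ := by gcongr

/-- The dispersive bound: the kernel of `P_k e^{-itΛ}` on the torus, multiplied by `R²`. -/
lemma exists_norm_kernel_le (hφ : IsCutoff φ) : ∃ A : ℝ, 0 < A ∧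
    ∀ (R : ℝ) (_ : 0 < R) (k : ℤ) (t : ℝ) (_ : 0 ≤ t) (x : Torus R),
      ‖∑' n, torusChar R n x * kleinGordonSymbol φ k t (freq R n)‖ ≤
        R ^ 2 * (A * ((1 + t)⁻¹ * (t / R + 1) ^ 2 * (2 : ℝ) ^ (2 * max k 0))) := by
  obtain ⟨B, hB0, hB⟩ := exists_norm_kernel_le_trivial hφ
  obtain ⟨C, hC⟩ := exists_schwartz_symbol hφ
  have hC0 : 0 ≤ C := by
    obtain ⟨f, hf, -⟩ := hC 0
    exact (integral_nonneg fun y => norm_nonneg _).trans hf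
  refine ⟨2 * B + 1280 / 3 * C, by positivity, fun R hR k t ht x => ?_⟩
  set P : ℝ := (2 : ℝ) ^ (2 * max k 0) with hP
  have hP0 : 0 < P := by positivity
  set Q : ℝ := (t / R + 1) ^ 2
  have hQ1 : 1 ≤ Q := one_le_pow₀ (by have : 0 ≤ t / R := by positivity
                                      linarith)
  rcases le_total t 1 with ht1 | ht1
  · refine (hB R hR k t x).trans (mul_le_mul_of_nonneg_left ?_ (by positivity))
    have h1 : 1 ≤ 2 * (1 + t)⁻¹ := by
      rw [← div_eq_mul_inv, one_le_div (by positivity)]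
      linarith
    calc B * P = B * (1 * 1 * P) := by ring
      _ ≤ B * (2 * (1 + t)⁻¹ * Q * P) := by gcongr
      _ = 2 * B * ((1 + t)⁻¹ * Q * P) := by ring
      _ ≤ _ := by
        refine mul_le_mul_of_nonneg_right ?_ (by positivity)
        have : 0 ≤ 1280 / 3 * C := by positivity
        linarith
  · obtain ⟨x, rfl⟩ := toTorus_surjective R x
    obtain ⟨f, hfC, hf⟩ := hC k
    set s : ℝ := ((2 : ℝ) ^ max k 0)⁻¹ with hs
    have hs0 : 0 < s := by positivity
    have hs1 : s ≤ 1 := inv_le_one_of_one_le₀ (one_le_zpow₀ one_le_two (le_max_right _ _))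
    have hsP : (s⁻¹) ^ 2 = P := by
      rw [hs, inv_inv, hP, ← zpow_natCast, ← zpow_mul, mul_comm]
      rfl
    have hΛ0 : ∀ n, 0 < lambdaSymbol (freq R n) := fun n =>
      one_pos.trans_le (one_le_lambdaSymbol _)
    set G : (Fin 2 → ℤ) → ℂ := fun n =>
      Complex.exp (-((s + t * Complex.I) * lambdaSymbol (freq R n))) / lambdaSymbol (freq R n)
      with hG
    have hGs : Summable fun n => ‖G n‖ := by
      refine (summable_exp_neg_lambdaSymbol hR hs0).of_nonneg_of_le (fun n => norm_nonneg _)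
        fun n => ?_
      rw [hG, norm_div, Complex.norm_exp, Complex.norm_real, Real.norm_of_nonneg (hΛ0 n).le]
      refine (div_le_self (Real.exp_pos _).le (one_le_lambdaSymbol _)).trans_eq ?_
      simp
    have hsym : ∀ n, torusChar R n (toTorus R x) * kleinGordonSymbol φ k t (freq R n) =
        (s⁻¹ : ℝ) * (torusChar R n (toTorus R x) * (f (((2 : ℝ) ^ k)⁻¹ • freq R n) * G n)) := by
      intro n
      have hΛc : (lambdaSymbol (freq R n) : ℂ) ≠ 0 := by exact_mod_cast (hΛ0 n).ne'
      have hsc : (s : ℂ) ≠ 0 := by exact_mod_cast hs0.ne'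
      have hexp : Complex.exp (-((s + t * Complex.I) * lambdaSymbol (freq R n))) =
          (Complex.exp (s * lambdaSymbol (freq R n)))⁻¹ *
            Complex.exp (-Complex.I * t * lambdaSymbol (freq R n)) := by
        rw [← Complex.exp_neg, ← Complex.exp_add]
        congr 1
        ring
      have hne := Complex.exp_ne_zero (s * lambdaSymbol (freq R n))
      rw [hf, hG, kleinGordonSymbol]
      simp only [hexp]
      push_cast
      field_simp
    simp only [hsym]
    rw [tsum_mul_left, norm_mul, Complex.norm_real, Real.norm_of_nonneg (by positivity)]
    have h := norm_tsum_schwartz_mul_le f ((2 : ℝ) ^ k)⁻¹ hGs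
      (norm_tsum_torusChar_mul_exp_le hR hs0 hs1 ht1) x
    have ht2 : t⁻¹ ≤ 2 * (1 + t)⁻¹ := by
      rw [← div_eq_mul_inv, inv_eq_one_div, div_le_div_iff₀ (by positivity) (by positivity)]
      linarith
    calc _ ≤ s⁻¹ * (C * (R ^ 2 * (640 / 3 * (s * t)⁻¹ * Q))) := by
          refine mul_le_mul_of_nonneg_left (h.trans ?_) (by positivity)
          exact mul_le_mul_of_nonneg_right hfC (by positivity)
      _ = R ^ 2 * (640 / 3 * C * (t⁻¹ * Q * (s⁻¹) ^ 2)) := by rw [mul_inv]; ring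
      _ ≤ R ^ 2 * (640 / 3 * C * (2 * (1 + t)⁻¹ * Q * (s⁻¹) ^ 2)) := by gcongr
      _ = R ^ 2 * (1280 / 3 * C * ((1 + t)⁻¹ * Q * P)) := by rw [hsP]; ring
      _ ≤ _ := by
        refine mul_le_mul_of_nonneg_left (mul_le_mul_of_nonneg_right ?_ ?_) (by positivity)
        · linarith
        · positivity

/-! ### Riesz–Thorin interpolation for finite-rank forms -/

section Interpolation

variable {α ι : Type*} [MeasurableSpace α]

/-- The bilinear form `∑ cₙ (∫ fₙ u) (∫ eₙ v)` of a finite-rank operator. -/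
def finiteRankForm (μ : Measure α) (S : Finset ι) (c : ι → ℂ) (f e : ι → α → ℂ) (u v : α → ℂ) : ℂ :=
  ∑ n ∈ S, c n * ((∫ x, f n x * u x ∂μ) * ∫ x, e n x * v x ∂μ)

/-- The analytic family `sgn(a) |a|^{p(1 - z/2)}`, with value `a` where `p(1 - z/2) = 1`.
For `a = 0` it vanishes identically, since `0 / 0 = 0`. -/
def powFamily (p : ℝ) (z a : ℂ) : ℂ := a / (‖a‖ : ℂ) * (‖a‖ : ℂ) ^ ((p : ℂ) * (1 - z / 2))

lemma powFamily_zero (p : ℝ) (z : ℂ) : powFamily p z 0 = 0 := by simp [powFamily]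

lemma norm_powFamily {p : ℝ} (hp : 0 < p) {z : ℂ} (hz : z.re ≤ 1) (a : ℂ) :
    ‖powFamily p z a‖ = ‖a‖ ^ (p * (1 - z.re / 2)) := by
  rcases eq_or_ne a 0 with rfl | ha
  · rw [powFamily_zero, norm_zero, Real.zero_rpow]
    have : 0 < p * (1 - z.re / 2) := mul_pos hp (by linarith)
    exact this.ne'
  · have hn : 0 < ‖a‖ := norm_pos_iff.2 ha
    rw [powFamily, norm_mul, norm_div, Complex.norm_real, norm_norm, div_self hn.ne', one_mul,
      Complex.norm_cpow_eq_rpow_re_of_pos hn]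
    congr 1
    simp

lemma differentiable_powFamily (p : ℝ) (a : ℂ) : Differentiable ℂ fun z => powFamily p z a := by
  rcases eq_or_ne a 0 with rfl | ha
  · simp only [powFamily_zero]
    fun_prop
  · have hn : (‖a‖ : ℂ) ≠ 0 := by exact_mod_cast norm_ne_zero_iff.2 ha
    unfold powFamily
    refine Differentiable.const_mul (fun z => ?_) _
    exact DifferentiableAt.const_cpow (by fun_prop) (Or.inl hn)

lemma powFamily_eq_self {p : ℝ} {z : ℂ} (h : (p : ℂ) * (1 - z / 2) = 1) (a : ℂ) :
    powFamily p z a = a := by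
  rcases eq_or_ne a 0 with rfl | ha
  · exact powFamily_zero p z
  · have hn : (‖a‖ : ℂ) ≠ 0 := by exact_mod_cast norm_ne_zero_iff.2 ha
    rw [powFamily, h, Complex.cpow_one, div_mul_cancel₀ _ hn]

lemma integral_mul_comp_simpleFunc {μ : Measure α} {f : α → ℂ} (hf : Integrable f μ)
    (u : SimpleFunc α ℂ) (g : ℂ → ℂ) :
    ∫ x, f x * g (u x) ∂μ = ∑ a ∈ u.range, g a * ∫ x in u ⁻¹' {a}, f x ∂μ := by
  classical
  have e : ∀ x, f x * g (u x) = ∑ a ∈ u.range, g a * (u ⁻¹' {a}).indicator f x := by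
    intro x
    rw [Finset.sum_eq_single (u x)]
    · simp [mul_comm]
    · intro b _ hb
      rw [indicator_of_notMem (by simpa using hb.symm), mul_zero]
    · intro h
      exact absurd (SimpleFunc.mem_range_self u x) h
  simp only [e]
  rw [integral_finsetSum _ fun a _ => ((hf.indicator (u.measurableSet_fiber a)).const_mul _)]
  refine Finset.sum_congr rfl fun a _ => ?_
  rw [integral_const_mul, integral_indicator (u.measurableSet_fiber a)]

lemma toReal_eLpNorm_eq {μ : Measure α} {p : ℝ≥0∞} (hp0 : p ≠ 0) (hpt : p ≠ ⊤)
    {u : α → ℂ} (hu : MemLp u p μ) :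
    (eLpNorm u p μ).toReal = (∫ x, ‖u x‖ ^ p.toReal ∂μ) ^ p.toReal⁻¹ := by
  rw [hu.eLpNorm_eq_integral_rpow_norm hp0 hpt, ENNReal.toReal_ofReal]
  exact Real.rpow_nonneg (integral_nonneg fun x => by positivity) _

variable {μ : Measure α} [IsFiniteMeasure μ]

lemma integrable_comp_simpleFunc {E : Type*} [NormedAddCommGroup E] (u : SimpleFunc α ℂ)
    (g : ℂ → E) : Integrable (fun x => g (u x)) μ :=
  (u.map g).integrable_of_isFiniteMeasure

/-- The Riesz–Thorin argument for simple functions, between `L¹ × L¹` and `L² × L²`. -/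
lemma norm_finiteRankForm_le_simpleFunc {S : Finset ι} {c : ι → ℂ} {f e : ι → α → ℂ}
    (hf : ∀ n, Integrable (f n) μ) (he : ∀ n, Integrable (e n) μ) {A M : ℝ}
    (h1 : ∀ u v : α → ℂ, Integrable u μ → Integrable v μ →
      ‖finiteRankForm μ S c f e u v‖ ≤ A * ((∫ x, ‖u x‖ ∂μ) * ∫ x, ‖v x‖ ∂μ))
    (h2 : ∀ u v : α → ℂ, MemLp u 2 μ → MemLp v 2 μ →
      ‖finiteRankForm μ S c f e u v‖ ≤
        M * (√(∫ x, ‖u x‖ ^ 2 ∂μ) * √(∫ x, ‖v x‖ ^ 2 ∂μ)))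
    (hA : 0 ≤ A) (hM : 0 ≤ M) {p : ℝ} (hp1 : 1 ≤ p) (hp2 : p ≤ 2) (u v : SimpleFunc α ℂ) :
    ‖finiteRankForm μ S c f e u v‖ ≤ A ^ (2 / p - 1) * M ^ (2 - 2 / p) *
      ((∫ x, ‖u x‖ ^ p ∂μ) ^ p⁻¹ * (∫ x, ‖v x‖ ^ p ∂μ) ^ p⁻¹) := by
  have hp0 : 0 < p := by linarith
  set U := ∫ x, ‖u x‖ ^ p ∂μ with hU
  set V := ∫ x, ‖v x‖ ^ p ∂μ with hV
  have hU0 : 0 ≤ U := integral_nonneg fun x => by positivity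
  have hV0 : 0 ≤ V := integral_nonneg fun x => by positivity
  set F : ℂ → ℂ := fun z => finiteRankForm μ S c f e (fun x => powFamily p z (u x))
    (fun x => powFamily p z (v x)) with hF
  have hFd : Differentiable ℂ F := by
    simp only [hF, finiteRankForm, integral_mul_comp_simpleFunc (hf _),
      integral_mul_comp_simpleFunc (he _)]
    have := differentiable_powFamily p
    fun_prop
  have hbd : ∀ (w : SimpleFunc α ℂ) (z : ℂ), 0 ≤ z.re → z.re ≤ 1 →
      ∫ x, ‖powFamily p z (w x)‖ ∂μ ≤ ∫ x, (1 + ‖w x‖) ^ p ∂μ := by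
    intro w z hz0 hz1
    refine integral_mono (integrable_comp_simpleFunc w fun a => ‖powFamily p z a‖)
      (integrable_comp_simpleFunc w fun a => (1 + ‖a‖) ^ p) fun x => ?_
    simp only [norm_powFamily hp0 hz1]
    calc ‖w x‖ ^ (p * (1 - z.re / 2)) ≤ (1 + ‖w x‖) ^ (p * (1 - z.re / 2)) :=
          Real.rpow_le_rpow (norm_nonneg _) (by linarith [norm_nonneg (w x)])
            (mul_nonneg hp0.le (by linarith))
      _ ≤ (1 + ‖w x‖) ^ p := Real.rpow_le_rpow_of_exponent_le (by linarith [norm_nonneg (w x)])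
            (mul_le_of_le_one_right hp0.le (by linarith))
  have hFb : BddAbove (norm ∘ F '' Complex.HadamardThreeLines.verticalClosedStrip 0 1) := by
    refine ⟨A * ((∫ x, (1 + ‖u x‖) ^ p ∂μ) * ∫ x, (1 + ‖v x‖) ^ p ∂μ), ?_⟩
    rintro _ ⟨z, hz, rfl⟩
    refine (h1 _ _ (integrable_comp_simpleFunc u _) (integrable_comp_simpleFunc v _)).trans ?_
    refine mul_le_mul_of_nonneg_left ?_ hA
    exact mul_le_mul (hbd u z hz.1 hz.2) (hbd v z hz.1 hz.2)
      (integral_nonneg fun x => norm_nonneg _) (integral_nonneg fun x => by positivity)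
  have hF0 : ∀ z ∈ Complex.re ⁻¹' {(0 : ℝ)}, ‖F z‖ ≤ A * (U * V) := by
    intro z hz
    have hz : z.re = 0 := hz
    have h := h1 _ _ (integrable_comp_simpleFunc u (powFamily p z))
      (integrable_comp_simpleFunc v (powFamily p z))
    simpa only [norm_powFamily hp0 (hz.trans_le zero_le_one), hz, zero_div, sub_zero, mul_one]
      using h
  have hsq : ∀ a : ℂ, (‖a‖ ^ (p * (1 - 1 / 2))) ^ 2 = ‖a‖ ^ p := fun a => by
    rw [← Real.rpow_natCast, ← Real.rpow_mul (norm_nonneg _)]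
    congr 1
    push_cast
    ring
  have hF1 : ∀ z ∈ Complex.re ⁻¹' {(1 : ℝ)}, ‖F z‖ ≤ M * (√U * √V) := by
    intro z hz
    have hz : z.re = 1 := hz
    have h := h2 _ _ ((u.map (powFamily p z)).memLp_of_isFiniteMeasure 2 μ)
      ((v.map (powFamily p z)).memLp_of_isFiniteMeasure 2 μ)
    simpa only [SimpleFunc.map_apply, SimpleFunc.coe_map, Function.comp_def,
      norm_powFamily hp0 hz.le, hz, hsq] using h
  set θ : ℝ := 2 - 2 / p with hθ
  have hθ0 : 0 ≤ θ := by
    have : 2 / p ≤ 2 := div_le_self (by norm_num) hp1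
    linarith
  have hθ1 : θ ≤ 1 := by
    have : 1 ≤ 2 / p := by rwa [one_le_div hp0]
    linarith
  have hmain := Complex.HadamardThreeLines.norm_le_interp_of_mem_verticalClosedStrip₀₁' F
    (z := (θ : ℂ)) ⟨by simpa using hθ0, by simpa using hθ1⟩ hFd.diffContOnCl hFb hF0 hF1
  have hFθ : F θ = finiteRankForm μ S c f e u v := by
    have hpc : (p : ℂ) ≠ 0 := by exact_mod_cast hp0.ne'
    have : (p : ℂ) * (1 - (θ : ℂ) / 2) = 1 := by
      rw [hθ]
      push_cast
      field_simp
      ring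
    simp only [hF, powFamily_eq_self this]
  rw [hFθ, Complex.ofReal_re] at hmain
  refine hmain.trans_eq ?_
  have e1 : 1 - θ = 2 / p - 1 := by rw [hθ]; ring
  have e2 : (1 - θ) + θ / 2 = p⁻¹ := by rw [hθ]; ring
  have hroot : ∀ W : ℝ, 0 ≤ W → W ^ (1 - θ) * (√W) ^ θ = W ^ p⁻¹ := by
    intro W hW
    rw [Real.sqrt_eq_rpow, ← Real.rpow_mul hW, ← Real.rpow_add_of_nonneg hW (by linarith)
      (by positivity), ← e2]
    congr 1
    ring
  rw [Real.mul_rpow hA (by positivity), Real.mul_rpow hM (by positivity),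
    Real.mul_rpow hU0 hV0, Real.mul_rpow (by positivity) (by positivity), ← hroot U hU0,
    ← hroot V hV0, e1]
  ring

lemma exists_simpleFunc_seq {p : ℝ≥0∞} (hp1 : 1 ≤ p) (hpt : p ≠ ⊤) {u : α → ℂ} (hu : MemLp u p μ) :
    ∃ w : ℕ → SimpleFunc α ℂ,
      (∀ k : ℕ, (eLpNorm (w k) p μ).toReal ≤ (eLpNorm u p μ).toReal + 1 / ((k : ℝ) + 1)) ∧
      ∀ f : α → ℂ, AEStronglyMeasurable f μ → (∀ x, ‖f x‖ ≤ 1) →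
        Tendsto (fun k => ∫ x, f x * w k x ∂μ) atTop (𝓝 (∫ x, f x * u x ∂μ)) := by
  have hex : ∀ k : ℕ, ∃ w : SimpleFunc α ℂ,
      eLpNorm (u - ⇑w) p μ < ENNReal.ofReal (1 / ((k : ℝ) + 1)) ∧ MemLp w p μ := fun k =>
    hu.exists_simpleFunc_eLpNorm_sub_lt hpt (by
      rw [Ne, ENNReal.ofReal_eq_zero, not_le]
      positivity)
  choose w hw hwm using hex
  refine ⟨w, fun k => ?_, fun f hf hf1 => ?_⟩
  · have h : eLpNorm (w k) p μ ≤ eLpNorm u p μ + ENNReal.ofReal (1 / ((k : ℝ) + 1)) := by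
      have e : (w k : α → ℂ) = u - (u - ⇑(w k)) := by simp
      conv_lhs => rw [e]
      refine (eLpNorm_sub_le hu.1 (hu.1.sub (hwm k).1) hp1).trans ?_
      gcongr
      exact (hw k).le
    have h2 := ENNReal.toReal_mono (by finiteness [hu.2.ne]) h
    rwa [ENNReal.toReal_add hu.2.ne ENNReal.ofReal_ne_top,
      ENNReal.toReal_ofReal (by positivity)] at h2
  · have hmul : ∀ g : α → ℂ, Integrable g μ → Integrable (fun x => f x * g x) μ := fun g hg =>
      hg.bdd_mul hf (Eventually.of_forall hf1)
    refine tendsto_integral_of_L1' _ (hmul u (hu.integrable hp1)).1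
      (Eventually.of_forall fun k => hmul _ ((hwm k).integrable hp1)) ?_
    have hlim : Tendsto (fun k : ℕ => ENNReal.ofReal (1 / ((k : ℝ) + 1)) *
        μ univ ^ (1 / (1 : ℝ≥0∞).toReal - 1 / p.toReal)) atTop (𝓝 0) := by
      have h0 : Tendsto (fun k : ℕ => ENNReal.ofReal (1 / ((k : ℝ) + 1))) atTop (𝓝 0) := by
        have := ENNReal.tendsto_ofReal (tendsto_one_div_add_atTop_nhds_zero_nat (𝕜 := ℝ))
        simpa using this
      have hfin : μ univ ^ (1 / (1 : ℝ≥0∞).toReal - 1 / p.toReal) ≠ ⊤ := by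
        refine ENNReal.rpow_ne_top_of_nonneg ?_ (measure_ne_top μ univ)
        have : 1 ≤ p.toReal := by
          have := ENNReal.toReal_mono hpt hp1
          simpa using this
        rw [ENNReal.toReal_one, div_one, sub_nonneg]
        exact (div_le_one (by linarith)).2 this
      have := ENNReal.Tendsto.mul_const h0 (Or.inr hfin)
      simpa using this
    refine tendsto_of_tendsto_of_tendsto_of_le_of_le tendsto_const_nhds hlim
      (fun k => zero_le) fun k => ?_
    calc eLpNorm ((fun x => f x * w k x) - fun x => f x * u x) 1 μ
        ≤ eLpNorm (u - ⇑(w k)) 1 μ := by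
          refine eLpNorm_mono fun x => ?_
          simp only [Pi.sub_apply]
          rw [← mul_sub, norm_mul, norm_sub_rev]
          exact mul_le_of_le_one_left (norm_nonneg _) (hf1 x)
      _ ≤ eLpNorm (u - ⇑(w k)) p μ * μ univ ^ (1 / (1 : ℝ≥0∞).toReal - 1 / p.toReal) :=
          eLpNorm_le_eLpNorm_mul_rpow_measure_univ hp1 (hu.1.sub (hwm k).1)
      _ ≤ _ := by
          gcongr
          exact (hw k).le

/-- Riesz–Thorin for finite-rank forms, between `L¹ × L¹` and `L² × L²`. -/
lemma norm_finiteRankForm_le {S : Finset ι} {c : ι → ℂ} {f e : ι → α → ℂ}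
    (hf : ∀ n, AEStronglyMeasurable (f n) μ) (he : ∀ n, AEStronglyMeasurable (e n) μ)
    (hf1 : ∀ n x, ‖f n x‖ ≤ 1) (he1 : ∀ n x, ‖e n x‖ ≤ 1) {A M : ℝ}
    (h1 : ∀ u v : α → ℂ, Integrable u μ → Integrable v μ →
      ‖finiteRankForm μ S c f e u v‖ ≤ A * ((∫ x, ‖u x‖ ∂μ) * ∫ x, ‖v x‖ ∂μ))
    (h2 : ∀ u v : α → ℂ, MemLp u 2 μ → MemLp v 2 μ →
      ‖finiteRankForm μ S c f e u v‖ ≤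
        M * (√(∫ x, ‖u x‖ ^ 2 ∂μ) * √(∫ x, ‖v x‖ ^ 2 ∂μ)))
    (hA : 0 ≤ A) (hM : 0 ≤ M) {p : ℝ≥0∞} (hp1 : 1 ≤ p) (hp2 : p ≤ 2) {u v : α → ℂ}
    (hu : MemLp u p μ) (hv : MemLp v p μ) :
    ‖finiteRankForm μ S c f e u v‖ ≤ A ^ (2 / p.toReal - 1) * M ^ (2 - 2 / p.toReal) *
      ((eLpNorm u p μ).toReal * (eLpNorm v p μ).toReal) := by
  have hpt : p ≠ ⊤ := (hp2.trans_lt (by norm_num)).ne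
  have hp0 : p ≠ 0 := (one_pos.trans_le hp1).ne'
  have hr1 : 1 ≤ p.toReal := by simpa using ENNReal.toReal_mono hpt hp1
  have hr2 : p.toReal ≤ 2 := by simpa using ENNReal.toReal_mono (by norm_num) hp2
  obtain ⟨a, ha, ha'⟩ := exists_simpleFunc_seq hp1 hpt hu
  obtain ⟨b, hb, hb'⟩ := exists_simpleFunc_seq hp1 hpt hv
  have hfi : ∀ n, Integrable (f n) μ := fun n =>
    (integrable_const (1 : ℝ)).mono' (hf n) (Eventually.of_forall (hf1 n))
  have hei : ∀ n, Integrable (e n) μ := fun n =>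
    (integrable_const (1 : ℝ)).mono' (he n) (Eventually.of_forall (he1 n))
  have hlim : Tendsto (fun k => finiteRankForm μ S c f e (a k) (b k)) atTop
      (𝓝 (finiteRankForm μ S c f e u v)) := by
    unfold finiteRankForm
    exact tendsto_finsetSum _ fun n _ =>
      ((ha' _ (hf n) (hf1 n)).mul (hb' _ (he n) (he1 n))).const_mul _
  have h0 := tendsto_one_div_add_atTop_nhds_zero_nat (𝕜 := ℝ)
  have hlim2 : Tendsto (fun k : ℕ => A ^ (2 / p.toReal - 1) * M ^ (2 - 2 / p.toReal) *
      (((eLpNorm u p μ).toReal + 1 / ((k : ℝ) + 1)) *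
        ((eLpNorm v p μ).toReal + 1 / ((k : ℝ) + 1)))) atTop
      (𝓝 (A ^ (2 / p.toReal - 1) * M ^ (2 - 2 / p.toReal) *
        ((eLpNorm u p μ).toReal * (eLpNorm v p μ).toReal))) := by
    have := ((h0.const_add (eLpNorm u p μ).toReal).mul
      (h0.const_add (eLpNorm v p μ).toReal)).const_mul
        (A ^ (2 / p.toReal - 1) * M ^ (2 - 2 / p.toReal))
    simpa only [add_zero] using this
  refine le_of_tendsto_of_tendsto' hlim.norm hlim2 fun k => ?_
  refine (norm_finiteRankForm_le_simpleFunc hfi hei h1 h2 hA hM hr1 hr2 (a k) (b k)).trans ?_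
  rw [← toReal_eLpNorm_eq hp0 hpt ((a k).memLp_of_isFiniteMeasure p μ),
    ← toReal_eLpNorm_eq hp0 hpt ((b k).memLp_of_isFiniteMeasure p μ)]
  refine mul_le_mul_of_nonneg_left ?_ (by positivity)
  exact mul_le_mul (ha k) (hb k) ENNReal.toReal_nonneg (by positivity)

/-- The converse of Hölder's inequality for a bounded function `w`, tested on
`conj w |w|^{q-2}`. -/
lemma eLpNorm_le_of_forall_integral_mul_le {p q : ℝ≥0∞} (hpt : p ≠ ⊤) (hqt : q ≠ ⊤)
    (hpq : p.toReal.HolderConjugate q.toReal) {w : α → ℂ} (hw : AEStronglyMeasurable w μ) {D : ℝ}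
    (hD : ∀ x, ‖w x‖ ≤ D) {K : ℝ} (hK0 : 0 ≤ K)
    (hK : ∀ v : α → ℂ, MemLp v p μ → ‖∫ x, w x * v x ∂μ‖ ≤ K * (eLpNorm v p μ).toReal) :
    eLpNorm w q μ ≤ ENNReal.ofReal K := by
  have hpr := hpq.pos
  have hqr := hpq.symm.pos
  have hqr1 := hpq.symm.sub_one_pos
  have hp0 : p ≠ 0 := fun h => by simp [h] at hpr
  have hq0 : q ≠ 0 := fun h => by simp [h] at hqr
  set v : α → ℂ := fun x =>
    (starRingEnd ℂ) (w x) / (‖w x‖ : ℂ) * ((‖w x‖ ^ (q.toReal - 1) : ℝ) : ℂ) with hv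
  have hvn : ∀ x, ‖v x‖ = ‖w x‖ ^ (q.toReal - 1) := by
    intro x
    rcases eq_or_ne (w x) 0 with h | h
    · simp [hv, h, Real.zero_rpow hqr1.ne']
    · have hn : 0 < ‖w x‖ := norm_pos_iff.2 h
      rw [hv, norm_mul, norm_div, Complex.norm_real, Complex.norm_real, norm_norm,
        RCLike.norm_conj, div_self hn.ne', one_mul, Real.norm_of_nonneg (by positivity)]
  have hwv : ∀ x, w x * v x = ((‖w x‖ ^ q.toReal : ℝ) : ℂ) := by
    intro x
    rcases eq_or_ne (w x) 0 with h | h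
    · simp [h, Real.zero_rpow hqr.ne']
    · have hn : 0 < ‖w x‖ := norm_pos_iff.2 h
      have hnc : (‖w x‖ : ℂ) ≠ 0 := by exact_mod_cast hn.ne'
      have e : ‖w x‖ ^ q.toReal = ‖w x‖ * ‖w x‖ ^ (q.toReal - 1) := by
        rw [Real.rpow_sub_one hn.ne']
        field_simp
      rw [hv, e]
      simp only
      rw [← mul_assoc, mul_div_assoc', Complex.mul_conj']
      push_cast
      field_simp
  have hvm : AEStronglyMeasurable v μ := by
    have hwa := hw.aemeasurable
    refine AEMeasurable.aestronglyMeasurable ?_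
    have := RCLike.continuous_conj (K := ℂ)
    refine ((this.measurable.comp_aemeasurable hwa).div ?_).mul ?_
    · fun_prop
    · fun_prop
  have hvL : MemLp v p μ :=
    MemLp.of_bound hvm (D ^ (q.toReal - 1)) <| Eventually.of_forall fun x => by
      rw [hvn]
      exact Real.rpow_le_rpow (norm_nonneg _) (hD x) hqr1.le
  have hwL : MemLp w q μ := MemLp.of_bound hw D (Eventually.of_forall hD)
  have h := hK v hvL
  simp only [hwv] at h
  have hvp : ∀ x, ‖v x‖ ^ p.toReal = ‖w x‖ ^ q.toReal := fun x => by
    rw [hvn, ← Real.rpow_mul (norm_nonneg _), hpq.symm.sub_one_mul_conj]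
  rw [integral_complex_ofReal, Complex.norm_real, toReal_eLpNorm_eq hp0 hpt hvL] at h
  simp only [hvp] at h
  rw [hwL.eLpNorm_eq_integral_rpow_norm hq0 hqt]
  refine ENNReal.ofReal_le_ofReal ?_
  set N := ∫ x, ‖w x‖ ^ q.toReal ∂μ
  have hN0 : 0 ≤ N := integral_nonneg fun x => by positivity
  rw [Real.norm_of_nonneg hN0] at h
  rcases hN0.eq_or_lt with hN | hN
  · rw [← hN, Real.zero_rpow (inv_pos.2 hqr).ne']
    exact hK0
  · have e : N ^ q.toReal⁻¹ * N ^ p.toReal⁻¹ = N := by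
      rw [← Real.rpow_add hN, add_comm, hpq.inv_add_inv_eq_one, Real.rpow_one]
    have hpos : 0 < N ^ p.toReal⁻¹ := Real.rpow_pos_of_pos hN _
    nth_rewrite 1 [← e] at h
    exact le_of_mul_le_mul_right h hpos

end Interpolation

/-! ### Mapping properties of `P_k e^{-itΛ}` -/

lemma torusChar_sub {R : ℝ} (n : Fin 2 → ℤ) (x y : Torus R) :
    torusChar R n (x - y) = torusChar R n x * (starRingEnd ℂ) (torusChar R n y) := by
  simp only [torusChar_eq_mul, fourier_apply, sub_eq_add_neg, Pi.add_apply, Pi.neg_apply,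
    smul_add, smul_neg, AddCircle.toCircle_add, AddCircle.toCircle_neg, Circle.coe_mul,
    Circle.coe_inv_eq_conj, map_mul]
  ring

lemma conj_torusChar_mul {R : ℝ} (n m : Fin 2 → ℤ) (x : Torus R) :
    (starRingEnd ℂ) (torusChar R n x) * torusChar R m x = torusChar R (m - n) x := by
  simp only [torusChar_eq_mul, sub_eq_add_neg, Pi.add_apply, Pi.neg_apply, fourier_add,
    fourier_neg, map_mul]
  ring

section Torus

variable {R : ℝ} [hR : Fact (0 < R)]

lemma integral_torusChar_eq_zero {n : Fin 2 → ℤ} (hn : n ≠ 0) :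
    ∫ x : Torus R, torusChar R n x = 0 := by
  obtain ⟨j, hj⟩ := Function.ne_iff.1 hn
  -- translation by half a period in the direction `j` changes the sign
  refine integral_eq_zero_of_add_right_eq_neg
    (g := Pi.single j ((R / 2 / n j : ℝ) : AddCircle R)) fun x => ?_
  rw [torusChar, torusChar, ← Finset.mul_prod_erase _ _ (Finset.mem_univ j),
    ← Finset.mul_prod_erase _ (fun i => fourier (n i) (x i)) (Finset.mem_univ j), Pi.add_apply,
    Pi.single_eq_same, fourier_add_half_inv_index hj hR.out, neg_mul]
  congr 2
  refine Finset.prod_congr rfl fun i hi => ?_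
  rw [Pi.add_apply, Pi.single_eq_of_ne (Finset.ne_of_mem_erase hi), add_zero]

lemma integral_torusChar_zero : ∫ x : Torus R, torusChar R 0 x = (R : ℂ) ^ 2 := by
  have h : ∀ x : Torus R, torusChar R 0 x = 1 := fun x => by simp [torusChar]
  simp only [h, integral_const]
  rw [measureReal_def, volume_pi, Measure.pi_univ]
  simp [AddCircle.measure_univ, hR.out.le, sq]

/-- Bessel's inequality for the characters of the torus. -/
lemma sum_norm_torusFourier_sq_le (S : Finset (Fin 2 → ℤ)) {u : Torus R → ℂ}
    (hu : MemLp u 2 volume) :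
    ∑ n ∈ S, ‖torusFourier u n‖ ^ 2 ≤ R ^ 2 * ∫ x, ‖u x‖ ^ 2 := by
  have hR0 := hR.out
  have hRc : (R : ℂ) ≠ 0 := by exact_mod_cast hR0.ne'
  have hmem : ∀ n, MemLp (fun x => (R : ℂ)⁻¹ * torusChar R n x) 2 (volume : Measure (Torus R)) :=
    fun n => MemLp.of_bound (continuous_const.mul (continuous_torusChar R n)).aestronglyMeasurable
      R⁻¹ (Eventually.of_forall fun x => by
        rw [norm_mul, norm_torusChar, mul_one, norm_inv, Complex.norm_real,
          Real.norm_of_nonneg hR0.le])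
  set v : (Fin 2 → ℤ) → Lp ℂ 2 (volume : Measure (Torus R)) := fun n => (hmem n).toLp _ with hv
  have hinner : ∀ n (w : Torus R → ℂ) (hw : MemLp w 2 volume),
      inner ℂ (v n) (hw.toLp w) = (R : ℂ)⁻¹ * torusFourier w n := by
    intro n w hw
    rw [L2.inner_def, torusFourier, ← integral_const_mul]
    refine integral_congr_ae ?_
    filter_upwards [(hmem n).coeFn_toLp, hw.coeFn_toLp] with x h1 h2
    rw [hv, h1, h2]
    simp
    ring
  have hon : Orthonormal ℂ v := by
    rw [orthonormal_iff_ite]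
    intro n m
    have : inner ℂ (v n) (v m) = (R : ℂ)⁻¹ * ((R : ℂ)⁻¹ * ∫ x, torusChar R (m - n) x) := by
      rw [hv, hinner, torusFourier, ← integral_const_mul (R : ℂ)⁻¹ (torusChar R (m - n))]
      congr 2
      funext x
      rw [← conj_torusChar_mul]
      ring
    rw [this]
    split_ifs with h
    · rw [h, sub_self, integral_torusChar_zero]
      field_simp
    · rw [integral_torusChar_eq_zero (sub_ne_zero.2 (Ne.symm h)), mul_zero, mul_zero]
  have hB := hon.sum_inner_products_le (hu.toLp u) (s := S)
  simp only [hinner, norm_mul, norm_inv, Complex.norm_real, Real.norm_of_nonneg hR0.le,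
    mul_pow] at hB
  have hnorm : ‖hu.toLp u‖ ^ 2 = ∫ x, ‖u x‖ ^ 2 := by
    rw [← @inner_self_eq_norm_sq ℂ, L2.inner_def, ← integral_re (L2.integrable_inner _ _)]
    refine integral_congr_ae ?_
    filter_upwards [hu.coeFn_toLp] with x h
    rw [h, inner_self_eq_norm_sq]
  rw [← Finset.mul_sum, hnorm, inv_pow, inv_mul_le_iff₀ (by positivity)] at hB
  exact hB

lemma torusFourier_conj (v : Torus R → ℂ) (n : Fin 2 → ℤ) :
    torusFourier (fun x => (starRingEnd ℂ) (v x)) n =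
      (starRingEnd ℂ) (∫ x, torusChar R n x * v x) := by
  rw [torusFourier, ← integral_conj]
  simp

lemma tsum_torusChar_eq_sum {φ : Plane → ℝ} (hφ : IsCutoff φ) (k : ℤ) (t : ℝ)
    (a : (Fin 2 → ℤ) → ℂ) (x : Torus R) :
    ∑' n, torusChar R n x * (kleinGordonSymbol φ k t (freq R n) * a n) =
      ∑ n ∈ freqBox R k, torusChar R n x * (kleinGordonSymbol φ k t (freq R n) * a n) :=
  tsum_eq_sum fun n hn => by
    rw [kleinGordonSymbol_eq_zero hφ hR.out k t hn, zero_mul, mul_zero]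

lemma lpKleinGordon_eq_sum {φ : Plane → ℝ} (hφ : IsCutoff φ) (k : ℤ) (t : ℝ) (u : Torus R → ℂ)
    (x : Torus R) :
    lpKleinGordon φ k t u x = ((R : ℂ) ^ 2)⁻¹ *
      ∑ n ∈ freqBox R k, torusChar R n x *
        (kleinGordonSymbol φ k t (freq R n) * torusFourier u n) := by
  rw [← tsum_torusChar_eq_sum hφ]
  rfl

lemma continuous_lpKleinGordon {φ : Plane → ℝ} (hφ : IsCutoff φ) (k : ℤ) (t : ℝ)
    (u : Torus R → ℂ) : Continuous (lpKleinGordon φ k t u) := by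
  have e : lpKleinGordon φ k t u = fun x => ((R : ℂ) ^ 2)⁻¹ *
      ∑ n ∈ freqBox R k, torusChar R n x *
        (kleinGordonSymbol φ k t (freq R n) * torusFourier u n) :=
    funext (lpKleinGordon_eq_sum hφ k t u)
  rw [e]
  exact continuous_const.mul (continuous_finsetSum _ fun n _ =>
    (continuous_torusChar R n).mul continuous_const)

lemma integrable_conj_torusChar_mul (n : Fin 2 → ℤ) {u : Torus R → ℂ} (hu : Integrable u) :
    Integrable fun x => (starRingEnd ℂ) (torusChar R n x) * u x :=
  hu.bdd_mul (c := 1) (continuous_torusChar R n).star.aestronglyMeasurable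
    (Eventually.of_forall fun x => by rw [RCLike.norm_conj, norm_torusChar])

lemma integrable_torusChar_mul (n : Fin 2 → ℤ) {u : Torus R → ℂ} (hu : Integrable u) :
    Integrable fun x => torusChar R n x * u x :=
  hu.bdd_mul (c := 1) (continuous_torusChar R n).aestronglyMeasurable
    (Eventually.of_forall fun x => by rw [norm_torusChar])

/-- The `L¹ → L^∞` bound: the operator is a convolution with its kernel. -/
lemma norm_lpKleinGordon_le {φ : Plane → ℝ} (hφ : IsCutoff φ) {k : ℤ} {t A : ℝ}
    (hA : ∀ x : Torus R, ‖∑' n, torusChar R n x * kleinGordonSymbol φ k t (freq R n)‖ ≤ R ^ 2 * A)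
    {u : Torus R → ℂ} (hu : Integrable u) (x : Torus R) :
    ‖lpKleinGordon φ k t u x‖ ≤ A * ∫ y, ‖u y‖ := by
  have hR0 := hR.out
  have e : lpKleinGordon φ k t u x = ((R : ℂ) ^ 2)⁻¹ *
      ∫ y, (∑' n, torusChar R n (x - y) * kleinGordonSymbol φ k t (freq R n)) * u y := by
    have h1 : ∀ y, (∑' n, torusChar R n (x - y) * kleinGordonSymbol φ k t (freq R n)) * u y =
        ∑ n ∈ freqBox R k, (torusChar R n x * kleinGordonSymbol φ k t (freq R n)) *
          ((starRingEnd ℂ) (torusChar R n y) * u y) := by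
      intro y
      have := tsum_torusChar_eq_sum hφ k t (fun _ => 1) (x - y)
      simp only [mul_one] at this
      rw [this, Finset.sum_mul]
      refine Finset.sum_congr rfl fun n _ => ?_
      rw [torusChar_sub]
      ring
    simp only [h1]
    rw [integral_finsetSum _ fun n _ => (integrable_conj_torusChar_mul n hu).const_mul _,
      lpKleinGordon_eq_sum hφ]
    congr 1
    refine Finset.sum_congr rfl fun n _ => ?_
    rw [integral_const_mul, torusFourier, mul_assoc]
  rw [e, norm_mul, norm_inv, norm_pow, Complex.norm_real, Real.norm_of_nonneg hR0.le,
    inv_mul_le_iff₀ (by positivity), ← mul_assoc, ← integral_const_mul]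
  refine norm_integral_le_of_norm_le (hu.norm.const_mul _) (Eventually.of_forall fun y => ?_)
  rw [norm_mul]
  exact mul_le_mul_of_nonneg_right (hA _) (norm_nonneg _)

/-- The bilinear form `∫ (P_k e^{-itΛ} u) v`. -/
def kleinGordonForm (φ : Plane → ℝ) (k : ℤ) (t : ℝ) (u v : Torus R → ℂ) : ℂ :=
  finiteRankForm volume (freqBox R k)
    (fun n => ((R : ℂ) ^ 2)⁻¹ * kleinGordonSymbol φ k t (freq R n))
    (fun n x => (starRingEnd ℂ) (torusChar R n x)) (torusChar R) u v

lemma kleinGordonForm_eq_integral {φ : Plane → ℝ} (hφ : IsCutoff φ) (k : ℤ) (t : ℝ)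
    (u : Torus R → ℂ) {v : Torus R → ℂ} (hv : Integrable v) :
    kleinGordonForm φ k t u v = ∫ x, lpKleinGordon φ k t u x * v x := by
  have h1 : ∀ x, lpKleinGordon φ k t u x * v x = ∑ n ∈ freqBox R k,
      (((R : ℂ) ^ 2)⁻¹ * kleinGordonSymbol φ k t (freq R n) * torusFourier u n) *
        (torusChar R n x * v x) := by
    intro x
    rw [lpKleinGordon_eq_sum hφ, Finset.mul_sum, Finset.sum_mul]
    refine Finset.sum_congr rfl fun n _ => ?_
    ring
  simp only [h1]
  rw [integral_finsetSum _ fun n _ => (integrable_torusChar_mul n hv).const_mul _, kleinGordonForm,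
    finiteRankForm]
  refine Finset.sum_congr rfl fun n _ => ?_
  rw [integral_const_mul, torusFourier]
  ring

lemma norm_kleinGordonForm_le_L1 {φ : Plane → ℝ} (hφ : IsCutoff φ) {k : ℤ} {t A : ℝ}
    (hA : ∀ x : Torus R, ‖∑' n, torusChar R n x * kleinGordonSymbol φ k t (freq R n)‖ ≤ R ^ 2 * A)
    {u v : Torus R → ℂ} (hu : Integrable u) (hv : Integrable v) :
    ‖kleinGordonForm φ k t u v‖ ≤ A * ((∫ x, ‖u x‖) * ∫ x, ‖v x‖) := by
  rw [kleinGordonForm_eq_integral hφ k t u hv, ← mul_assoc, ← integral_const_mul]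
  refine norm_integral_le_of_norm_le (hv.norm.const_mul _) (Eventually.of_forall fun x => ?_)
  rw [norm_mul]
  exact mul_le_mul_of_nonneg_right (norm_lpKleinGordon_le hφ hA hu x) (norm_nonneg _)

lemma norm_kleinGordonForm_le_L2 {φ : Plane → ℝ} {k : ℤ} {t B : ℝ}
    (hB : ∀ ξ, ‖kleinGordonSymbol φ k t ξ‖ ≤ B) {u v : Torus R → ℂ} (hu : MemLp u 2 volume)
    (hv : MemLp v 2 volume) :
    ‖kleinGordonForm φ k t u v‖ ≤ B * (√(∫ x, ‖u x‖ ^ 2) * √(∫ x, ‖v x‖ ^ 2)) := by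
  have hR0 := hR.out
  have hB0 : 0 ≤ B := (norm_nonneg _).trans (hB 0)
  set a : (Fin 2 → ℤ) → ℝ := fun n => ‖torusFourier u n‖
  set b : (Fin 2 → ℤ) → ℝ := fun n => ‖∫ x, torusChar R n x * v x‖
  have hterm : ‖kleinGordonForm φ k t u v‖ ≤
      ∑ n ∈ freqBox R k, (R ^ 2)⁻¹ * B * (a n * b n) := by
    refine norm_sum_le_of_le _ fun n _ => ?_
    rw [norm_mul, norm_mul, norm_mul, norm_inv, norm_pow, Complex.norm_real,
      Real.norm_of_nonneg hR0.le]
    refine mul_le_mul_of_nonneg_right ?_ (by positivity)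
    exact mul_le_mul_of_nonneg_left (hB _) (by positivity)
  have ha := sum_norm_torusFourier_sq_le (freqBox R k) hu
  have hb : ∑ n ∈ freqBox R k, b n ^ 2 ≤ R ^ 2 * ∫ x, ‖v x‖ ^ 2 := by
    have h := sum_norm_torusFourier_sq_le (freqBox R k) hv.star
    have e : (star v : Torus R → ℂ) = fun x => (starRingEnd ℂ) (v x) := rfl
    rw [e] at h
    simpa only [torusFourier_conj, RCLike.norm_conj] using h
  have hcs := Real.sum_mul_le_sqrt_mul_sqrt (freqBox R k) a b
  have hfin : ∑ n ∈ freqBox R k, a n * b n ≤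
      R ^ 2 * (√(∫ x, ‖u x‖ ^ 2) * √(∫ x, ‖v x‖ ^ 2)) := by
    refine hcs.trans ((mul_le_mul (Real.sqrt_le_sqrt ha) (Real.sqrt_le_sqrt hb)
      (Real.sqrt_nonneg _) (Real.sqrt_nonneg _)).trans_eq ?_)
    rw [Real.sqrt_mul (by positivity), Real.sqrt_mul (by positivity), Real.sqrt_sq hR0.le]
    ring
  rw [← Finset.mul_sum] at hterm
  refine hterm.trans ((mul_le_mul_of_nonneg_left hfin (by positivity)).trans_eq ?_)
  field_simp

/-- Interpolation of the `L¹ → L^∞` and `L² → L²` bounds. -/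
lemma eLpNorm_lpKleinGordon_le {φ : Plane → ℝ} (hφ : IsCutoff φ) {k : ℤ} {t A B : ℝ} (hA0 : 0 ≤ A)
    (hA : ∀ x : Torus R, ‖∑' n, torusChar R n x * kleinGordonSymbol φ k t (freq R n)‖ ≤ R ^ 2 * A)
    (hB : ∀ ξ, ‖kleinGordonSymbol φ k t ξ‖ ≤ B) {p q : ℝ≥0∞} (hp1 : 1 ≤ p) (hpq : p ≤ q)
    (hconj : p⁻¹ + q⁻¹ = 1) {u : Torus R → ℂ} (hu : MemLp u p volume) :
    eLpNorm (lpKleinGordon φ k t u) q volume ≤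
      ENNReal.ofReal (A ^ (p⁻¹.toReal - q⁻¹.toReal) * B ^ (1 - (p⁻¹.toReal - q⁻¹.toReal))) *
        eLpNorm u p volume := by
  have hB0 : 0 ≤ B := (norm_nonneg _).trans (hB 0)
  have hui := hu.integrable hp1
  have hpinv : p⁻¹ ≠ ⊤ := fun h => by simp [h] at hconj
  have hqinv : q⁻¹ ≠ ⊤ := fun h => by simp [h] at hconj
  have hsum : p⁻¹.toReal + q⁻¹.toReal = 1 := by
    rw [← ENNReal.toReal_add hpinv hqinv, hconj, ENNReal.toReal_one]
  have hle : q⁻¹.toReal ≤ p⁻¹.toReal := ENNReal.toReal_mono hpinv (ENNReal.inv_le_inv.2 hpq)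
  rcases hp1.eq_or_lt with rfl | hp1'
  · have hq : q = ⊤ := by
      rw [inv_one] at hconj
      have : q⁻¹ = 0 := by
        have h := congrArg (· - 1) hconj
        simpa using h
      simpa using this
    subst hq
    simp only [inv_one, ENNReal.inv_top, ENNReal.toReal_one, ENNReal.toReal_zero, sub_zero,
      Real.rpow_one, sub_self, Real.rpow_zero, mul_one]
    rw [eLpNorm_exponent_top, eLpNorm_one_eq_lintegral_enorm,
      ← ofReal_integral_norm_eq_lintegral_enorm hui, ← ENNReal.ofReal_mul hA0]
    exact eLpNormEssSup_le_of_ae_bound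
      (Eventually.of_forall fun x => norm_lpKleinGordon_le hφ hA hui x)
  · have hpinv0 : p⁻¹.toReal < 1 := by
      have : p⁻¹ < 1 := ENNReal.inv_lt_one.2 hp1'
      simpa using ENNReal.toReal_strict_mono ENNReal.one_ne_top this
    have hqt : q ≠ ⊤ := by
      rintro rfl
      simp at hsum
      simp [hsum] at hpinv0
    have hpt : p ≠ ⊤ := ne_top_of_le_ne_top hqt hpq
    have hpr : 1 < p.toReal := by simpa using ENNReal.toReal_strict_mono hpt hp1'
    rw [ENNReal.toReal_inv] at hpinv0
    rw [ENNReal.toReal_inv, ENNReal.toReal_inv] at hsum hle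
    rw [ENNReal.toReal_inv, ENNReal.toReal_inv]
    have hp2 : p ≤ 2 := by
      refine (ENNReal.toReal_le_toReal hpt (by norm_num)).1 ?_
      have h1 : 1 / 2 ≤ p.toReal⁻¹ := by linarith
      have : p.toReal ≤ (1 / 2)⁻¹ := by
        rw [le_inv_comm₀ (by linarith) (by norm_num)]
        exact h1
      simpa using this
    have hHC : p.toReal.HolderConjugate q.toReal := Real.holderConjugate_iff.2 ⟨hpr, hsum⟩
    have e1 : 2 / p.toReal - 1 = p.toReal⁻¹ - q.toReal⁻¹ := by
      rw [div_eq_mul_inv]; linarith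
    have e2 : 2 - 2 / p.toReal = 1 - (p.toReal⁻¹ - q.toReal⁻¹) := by
      rw [div_eq_mul_inv]; linarith
    set K := A ^ (p.toReal⁻¹ - q.toReal⁻¹) * B ^ (1 - (p.toReal⁻¹ - q.toReal⁻¹)) with hK
    have hK0 : 0 ≤ K := by positivity
    have hdual := eLpNorm_le_of_forall_integral_mul_le (μ := (volume : Measure (Torus R)))
      (K := K * (eLpNorm u p volume).toReal) hpt hqt hHC
      (continuous_lpKleinGordon hφ k t u).aestronglyMeasurable
      (norm_lpKleinGordon_le hφ hA hui) (by positivity) (fun v hv => by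
        rw [← kleinGordonForm_eq_integral hφ k t u (hv.integrable hp1), mul_assoc, hK, ← e2, ← e1]
        exact norm_finiteRankForm_le
          (fun n => (continuous_torusChar R n).star.aestronglyMeasurable)
          (fun n => (continuous_torusChar R n).aestronglyMeasurable)
          (fun n x => by rw [norm_star, norm_torusChar])
          (fun n x => by rw [norm_torusChar])
          (fun u v hu hv => norm_kleinGordonForm_le_L1 hφ hA hu hv)
          (fun u v hu hv => norm_kleinGordonForm_le_L2 hB hu hv) hA0 hB0 hp1 hp2 hu hv)
    rwa [ENNReal.ofReal_mul hK0, ENNReal.ofReal_toReal hu.2.ne] at hdual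

end Torus

end KleinGordonTorus

end

open KleinGordonTorus in
theorem lemma3p1 (φ : EuclideanSpace ℝ (Fin 2) → ℝ) (hφ : IsCutoff φ) :
    ∃ C : ℝ, 0 < C ∧
      ∀ (R : ℝ) [Fact (0 < R)] (k : ℤ) (t : ℝ), 0 ≤ t →
      ∀ p q : ℝ≥0∞, 1 ≤ p → p ≤ q → p⁻¹ + q⁻¹ = 1 →
      ∀ u : Torus R → ℂ, MemLp u p volume →
        eLpNorm (lpKleinGordon φ k t u) q volume ≤
          ENNReal.ofReal
            (C * ((1 + t)⁻¹ * (t / R + 1) ^ 2 * (2 : ℝ) ^ (2 * max k 0)) ^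
              (p⁻¹.toReal - q⁻¹.toReal)) * eLpNorm u p volume := by
  obtain ⟨A, hA0, hA⟩ := exists_norm_kernel_le hφ
  obtain ⟨B, hB0, hB⟩ := exists_abs_lpSymbol_le hφ
  refine ⟨max A B, lt_max_of_lt_left hA0, fun R hR k t ht p q hp1 hpq hconj u hu => ?_⟩
  have hR0 := hR.out
  set D : ℝ := (1 + t)⁻¹ * (t / R + 1) ^ 2 * (2 : ℝ) ^ (2 * max k 0)
  have hD0 : 0 ≤ D := by positivity
  refine (eLpNorm_lpKleinGordon_le hφ (A := A * D) (B := B) (by positivity) (hA R hR0 k t ht)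
    (fun ξ => (norm_kleinGordonSymbol φ k t ξ).trans_le (hB k ξ)) hp1 hpq hconj hu).trans ?_
  gcongr ENNReal.ofReal ?_ * _
  have hpinv : p⁻¹ ≤ 1 := ENNReal.inv_le_one.2 hp1
  have hσ0 : 0 ≤ p⁻¹.toReal - q⁻¹.toReal := sub_nonneg.2
    (ENNReal.toReal_mono (ne_top_of_le_ne_top ENNReal.one_ne_top hpinv)
      (ENNReal.inv_le_inv.2 hpq))
  have hσ1 : p⁻¹.toReal - q⁻¹.toReal ≤ 1 := by
    have h1 : p⁻¹.toReal ≤ 1 := by simpa using ENNReal.toReal_mono ENNReal.one_ne_top hpinv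
    have h2 : 0 ≤ q⁻¹.toReal := ENNReal.toReal_nonneg
    linarith
  set σ := p⁻¹.toReal - q⁻¹.toReal
  have hAB : 0 < max A B := lt_max_of_lt_left hA0
  calc (A * D) ^ σ * B ^ (1 - σ) = (A ^ σ * B ^ (1 - σ)) * D ^ σ := by
        rw [Real.mul_rpow hA0.le hD0]; ring
    _ ≤ (max A B ^ σ * max A B ^ (1 - σ)) * D ^ σ := by
        refine mul_le_mul_of_nonneg_right ?_ (by positivity)
        exact mul_le_mul (Real.rpow_le_rpow hA0.le (le_max_left _ _) hσ0)
          (Real.rpow_le_rpow hB0.le (le_max_right _ _) (by linarith)) (by positivity)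
          (by positivity)
    _ = max A B * D ^ σ := by
        rw [← Real.rpow_add hAB, add_sub_cancel, Real.rpow_one]
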